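/- For an integer $T\ge 1$ let $\Psi_T=\frac1{\sqrt T}\sum_{i=0}^{T-1}|i\rangle^A|i\rangle^B$, and for a (mixed) state $\rho$ on $\mathcal H_T^A\otimes\mathcal H_T^B$ let its fidelity be $F(\rho)=\langle\Psi_T|\rho|\Psi_T\rangle$. A general entanglement purification protocol (GEPP) $\mathcal P$ with dimensions $N,K,M$ is a protocol of local operations and classical communication in which Alice and Bob share an input state $\rho$ on $\mathcal H_N^A\otimes\mathcal H_N^B$ and the auxiliary state $\Psi_K$, and end either by announcing $\mathsf{FAIL}$ or by outputting a state $\mathcal P(\rho)$ on $\mathcal H_M^A\otimes\mathcal H_M^B$; $\mathcal P(\rho)$ is a random variable, depending on all random choices and measurement outcomes. The protocol is probabilistically conditionally successful with parameter $\langle N,K,M,\epsilon,\delta,p,q\rangle$ if for every input state $\rho$ with $F(\rho)\ge 1-\epsilon$ (in particular for every one with $F(\rho)=1-\epsilon$) $$\Pr[\mathcal P(\rho)=\mathsf{FAIL}]\le p\quad\text{and}\quad \Pr[F(\mathcal P(\rho))\ge 1-\delta\mid \mathcal P(\rho)\ne\mathsf{FAIL}]\ge 1-q .$$ A family of such protocols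 is efficient if there are constants $C,c$ such that every member is implemented by quantum circuits of size at most $C(\log_2 N+\log_2 K)^c$. **Theorem.** For all integers $n>t\ge 0$ and $d\ge 1$ and all real $\epsilon<1/2$ there exist efficient probabilistically conditionally successful GEPPs (for arbitrary input states) with each of the following parameters; in each of the three families the constants $C,c$ do not depend on $n,t,d,\epsilon$: 1. $\left\langle 2^n,\ (2^n-1)2^{2t},\ 2^{n-t}(2^n-1),\ \epsilon,\ \frac{\epsilon}{2^{t-3}},\ 2\epsilon+\sqrt{\frac{2\epsilon}{2^t}},\ \frac1{2^t}\right\rangle$; 2. $\left\langle 2^{2n},\ (2^n+1)2^{2t},\ 2^{n}(2^n+1),\ \epsilon,\ \frac{\epsilon}{2^{t-3}},\ 2\epsilon+\sqrt{\frac{2\epsilon}{2^t}},\ \frac1{2^t}\right\rangle$; 3. $\left\langle 2^{dn},\ \frac{2^{dn}-1}{2^n-1}\cdot 2^{2t},\ 2^{(d-1)n}\cdot\frac{2^{dn}-1}{2^n-1},\ \epsilon,\ \frac{\epsilon}{2^{t-3}},\ 2\epsilon+\sqrt{\frac{2\epsilon}{2^t}},\ \frac1{2^t}\right\rangle$. 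-/

import Mathlib

open scoped Kronecker Matrix ComplexOrder

/-! ### Bipartite states and fidelity -/

/-- A (mixed) state: a density matrix. -/
def IsState {ι : Type*} [Fintype ι] (ρ : Matrix ι ι ℂ) : Prop :=
  ρ.PosSemidef ∧ ρ.trace = 1

/-- The maximally entangled vector `Ψ_T = T^(-1/2) ∑ i, |i⟩|i⟩`. -/
noncomputable def maxEnt (T : ℕ) : Fin T × Fin T → ℂ :=
  fun p => if p.1 = p.2 then ((1 / Real.sqrt T : ℝ) : ℂ) else 0

/-- The fidelity `⟨Ψ_T| ρ |Ψ_T⟩` of a bipartite state. -/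
noncomputable def fidelity {T : ℕ} (ρ : Matrix (Fin T × Fin T) (Fin T × Fin T) ℂ) : ℝ :=
  (star (maxEnt T) ⬝ᵥ (ρ *ᵥ maxEnt T)).re

/-! ### Circuits of one party on `w` qubits -/

/-- Computational basis labels of `w` qubits. -/
abbrev Qubits (w : ℕ) : Type := Fin w → Bool

/-- Elementary gates: NOT, Hadamard, the phase gate `T = diag(1, e^{iπ/4})`,
CNOT (control, target) and Toffoli (control, control, target). -/
inductive Gate (w : ℕ) : Type
  | not (i : Fin w) : Gate w
  | had (i : Fin w) : Gate w
  | phase (i : Fin w) : Gate w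
  | cnot (i j : Fin w) (hij : i ≠ j) : Gate w
  | toffoli (i j k : Fin w) (hij : i ≠ j) (hik : i ≠ k) (hjk : j ≠ k) : Gate w

/-- The operator `|y⟩ ↦ |f y⟩`. -/
def basisMap {w : ℕ} (f : Qubits w → Qubits w) : Matrix (Qubits w) (Qubits w) ℂ :=
  fun x y => if x = f y then 1 else 0

/-- The unitary matrix of a gate. -/
noncomputable def Gate.toMatrix {w : ℕ} : Gate w → Matrix (Qubits w) (Qubits w) ℂ
  | .not i => basisMap fun y => Function.update y i (!(y i))
  | .had i => fun x y =>
      if ∀ j, j ≠ i → x j = y j then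
        (if (x i && y i) = true then -1 else 1) * ((1 / Real.sqrt 2 : ℝ) : ℂ)
      else 0
  | .phase i => Matrix.diagonal fun x =>
      if x i = true then Complex.exp (Complex.I * (Real.pi / 4 : ℝ)) else 1
  | .cnot i j _ => basisMap fun y => Function.update y j (xor (y j) (y i))
  | .toffoli i j k _ _ _ => basisMap fun y => Function.update y k (xor (y k) (y i && y j))

/-- The projector onto the states whose qubit `i` has the value `b`. -/
def proj {w : ℕ} (i : Fin w) (b : Bool) : Matrix (Qubits w) (Qubits w) ℂ :=
  Matrix.diagonal fun x => if x i = b then 1 else 0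

/-! ### Two-party protocols: local operations and classical communication -/

inductive Party : Type
  | alice
  | bob

/-- Operators on the joint space of Alice's `w` qubits and Bob's `w` qubits. -/
abbrev JointOp (w : ℕ) : Type :=
  Matrix (Qubits w × Qubits w) (Qubits w × Qubits w) ℂ

/-- The product operator in which the named party applies `U` and the other one `V`. -/
def localOp {w : ℕ} (P : Party) (U V : Matrix (Qubits w) (Qubits w) ℂ) : JointOp w :=
  match P with
  | .alice => U ⊗ₖ V
  | .bob => V ⊗ₖ U

/-- One step of a protocol.
* `gate P g`: party `P` applies the gate `g` to its own qubits.
* `measure P i`: party `P` measures its qubit `i` in the computational basis.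
* `send P i j`: party `P` measures its qubit `i` in the computational basis and sends the
  resulting classical bit to the other party, who applies NOT to its own qubit `j` if the bit
  is `1` (so a qubit `j` in the state `|0⟩` stores the received bit).
Randomness is obtained by measuring ancillas. -/
inductive Step (w : ℕ) : Type
  | gate (P : Party) (g : Gate w) : Step w
  | measure (P : Party) (i : Fin w) : Step w
  | send (P : Party) (i j : Fin w) : Step w

/-- The operators of a step, one for each possible measurement outcome. -/
noncomputable def Step.ops {w : ℕ} : Step w → List (JointOp w)
  | .gate P g => [localOp P g.toMatrix 1]
  | .measure P i => [localOp P (proj i false) 1, localOp P (proj i true) 1]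
  | .send P i j =>
      [localOp P (proj i false) 1, localOp P (proj i true) (Gate.not j).toMatrix]

/-- The list, over all sequences of measurement outcomes, of the unnormalized states after the
program was run on `σ`; the trace of an entry is the probability of its sequence. -/
noncomputable def branches {w : ℕ} : List (Step w) → JointOp w → List (JointOp w)
  | [], σ => [σ]
  | s :: l, σ => s.ops.flatMap fun A => branches l (A * σ * Aᴴ)

/-- The `k`-bit binary representation of `x`. -/
def bits (k x : ℕ) : Fin k → Bool := fun i => x.testBit i

/-- A protocol that takes a state of dimension `N × N` and the auxiliary state `Ψ_K` and
outputs `FAIL` or a state of dimension `M × M`. Each party holds `width` qubits. Its parts of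
the input and of the auxiliary state are stored in binary on the wires `inWire` and `auxWire`,
the other qubits start as `|0⟩`. In the end Alice measures her qubit `failWire` and announces
the result, `1` meaning `FAIL`; otherwise the qubits on the wires `outWire` are the output and
all other qubits are discarded. -/
structure Protocol (N K M : ℕ) where
  width : ℕ
  wires : Fin (Nat.clog 2 N) ⊕ Fin (Nat.clog 2 K) ↪ Fin width
  outWire : Fin (Nat.clog 2 M) ↪ Fin width
  failWire : Fin width
  program : List (Step width)

namespace Protocol

variable {N K M : ℕ}

/-- The circuit size: the number of operations plus the number of qubits of both parties. -/
def size (P : Protocol N K M) : ℕ := P.program.length + 2 * P.width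

/-- One party's initial basis label when its input is `x` and its auxiliary input is `y`. -/
noncomputable def load (P : Protocol N K M) (x : Fin N) (y : Fin K) : Qubits P.width :=
  Function.extend P.wires
    (Sum.elim (bits (Nat.clog 2 N) x) (bits (Nat.clog 2 K) y)) (fun _ => false)

/-- The isometry that stores input and auxiliary input in the qubits. -/
noncomputable def loadOp (P : Protocol N K M) :
    Matrix (Qubits P.width × Qubits P.width) ((Fin N × Fin N) × (Fin K × Fin K)) ℂ :=
  fun q r => if q = (P.load r.1.1 r.2.1, P.load r.1.2 r.2.2) then 1 else 0

/-- The initial joint state: `ρ ⊗ |Ψ_K⟩⟨Ψ_K|` and ancillas `|0⟩`. -/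
noncomputable def initial (P : Protocol N K M) (ρ : Matrix (Fin N × Fin N) (Fin N × Fin N) ℂ) :
    JointOp P.width :=
  P.loadOp * (ρ ⊗ₖ Matrix.vecMulVec (maxEnt K) (star (maxEnt K))) * P.loadOpᴴ

/-- `a` has the binary representation of `x` on the output wires. -/
def Reads (P : Protocol N K M) (a : Qubits P.width) (x : Fin M) : Prop :=
  ∀ i, a (P.outWire i) = bits (Nat.clog 2 M) x i

/-- `a` and `a'` agree on all discarded wires. -/
def AgreeOff (P : Protocol N K M) (a a' : Qubits P.width) : Prop :=
  ∀ i, i ∉ Set.range P.outWire → a i = a' i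

open Classical in
/-- The (unnormalized) state of the output wires: the partial trace over all other wires, as a
matrix on the basis `|x⟩|y⟩` with `x, y < M`. -/
noncomputable def readOut (P : Protocol N K M) (σ : JointOp P.width) :
    Matrix (Fin M × Fin M) (Fin M × Fin M) ℂ :=
  fun r s => ∑ q : Qubits P.width × Qubits P.width, ∑ q' : Qubits P.width × Qubits P.width,
    if P.Reads q.1 r.1 ∧ P.Reads q.2 r.2 ∧ P.Reads q'.1 s.1 ∧ P.Reads q'.2 s.2 ∧
        P.AgreeOff q.1 q'.1 ∧ P.AgreeOff q.2 q'.2 then σ q q' else 0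

/-- What the protocol ends with: its probability, and `none` for `FAIL` or `some τ` for the
output state `τ`. -/
abbrev Result (M : ℕ) : Type := ℝ × Option (Matrix (Fin M × Fin M) (Fin M × Fin M) ℂ)

/-- The two results, `FAIL` and success, of a final joint state. -/
noncomputable def finish (P : Protocol N K M) (σ : JointOp P.width) : List (Result M) :=
  let E (b : Bool) : JointOp P.width := localOp .alice (proj P.failWire b) 1
  let bad := E true * σ * (E true)ᴴ
  let good := E false * σ * (E false)ᴴ
  [(bad.trace.re, none), (good.trace.re, some (good.trace⁻¹ • P.readOut good))]

/-- The random variable `P(ρ)`, listed over all sequences of measurement outcomes. Each listed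
output state is the state conditioned on the whole sequence. -/
noncomputable def results (P : Protocol N K M)
    (ρ : Matrix (Fin N × Fin N) (Fin N × Fin N) ℂ) : List (Result M) :=
  (branches P.program (P.initial ρ)).flatMap P.finish

open Classical in
/-- The probability of an event about `P(ρ)`. -/
noncomputable def prob (P : Protocol N K M) (ρ : Matrix (Fin N × Fin N) (Fin N × Fin N) ℂ)
    (E : Option (Matrix (Fin M × Fin M) (Fin M × Fin M) ℂ) → Prop) : ℝ :=
  ((P.results ρ).map fun r => if E r.2 then r.1 else 0).sum

/-- Whenever the protocol does not fail, it outputs a state of dimension `M × M`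
(no weight on binary numbers that are at least `M`). -/
def IsGEPP (P : Protocol N K M) : Prop :=
  ∀ ρ, IsState ρ → ∀ r ∈ P.results ρ, r.1 ≠ 0 → ∀ τ, r.2 = some τ → IsState τ

/-- Probabilistically conditionally successful with parameter `⟨N, K, M, ε, δ, p, q⟩`: on every
input of fidelity at least `1 - ε` the protocol fails with probability at most `p`, and,
conditioned on not failing, it outputs a state of fidelity at least `1 - δ` with probability at
least `1 - q`. The conditional probability is multiplied out, so that the second condition is
void if failure is certain. -/
def ProbSuccessful (P : Protocol N K M) (ε δ p q : ℝ) : Prop :=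
  P.IsGEPP ∧ ∀ ρ, IsState ρ → 1 - ε ≤ fidelity ρ →
    P.prob ρ (fun r => r = none) ≤ p ∧
    (1 - q) * P.prob ρ (fun r => r ≠ none) ≤
      P.prob ρ (fun r => ∃ τ, r = some τ ∧ 1 - δ ≤ fidelity τ)

end Protocol

/-- The protocol has size at most `C (log N + log K)^c`. -/
def SizeBound {N K M : ℕ} (P : Protocol N K M) (C c : ℕ) : Prop :=
  (P.size : ℝ) ≤ C * (Real.logb 2 N + Real.logb 2 K) ^ c

/-!
A positive semidefinite input is an ensemble of unnormalized vectors `χ`. In each check both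
parties draw a random Pauli operator `X^u Z^v`, apply it controlled on their halves of a maximally
entangled pair of qubits, and compare the measured halves; passing the check projects `χ` to
`(χ + X^u Z^v χ) / 2`. The operator fixes the maximally entangled vector, so the squared overlap
with it never changes. The average of the Pauli operators is the projection to that vector, so the
remaining squared norm is halved on average.

After `T = 2 * t` checks the total defect (squared norm minus squared overlap) of the successful
runs is at most `ε / 4^t`, while the probability of success is at least `1 - ε`. Markov's
inequality with the thresholds `8ε / 2^t` and `2^(-t)` bounds the probability of a bad output. Any
`u` qubits of a maximally entangled input, together with the unused part of the auxiliary state,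
are again maximally entangled, which gives the output dimension `2^u * L`.
-/

/-! ### Circuits acting on amplitudes -/

/-- The sign character `b ↦ (-1)^b`. Throughout, `Bool` carries its Boolean ring structure:
`+` is exclusive or and `*` is conjunction. -/
def sgn (b : Bool) : ℂ := if b then -1 else 1

lemma sgn_zero : sgn 0 = 1 := rfl

lemma sgn_add (a b : Bool) : sgn (a + b) = sgn a * sgn b := by
  cases a <;> cases b <;> simp [sgn, Bool.add_eq_xor]

lemma boolVec_add_self {ι : Type*} (a : ι → Bool) : a + a = 0 := by
  ext i; simp [BooleanRing.add_self]

lemma boolVec_add_cancel_right {ι : Type*} (a b : ι → Bool) : a + b + b = a := by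
  rw [add_assoc, boolVec_add_self, add_zero]

section Circuits

variable {w : ℕ} {κ : Type*}

lemma update_add_single (a : Qubits w) (i : Fin w) (c : Bool) :
    Function.update a i (a i + c) = a + Pi.single i c := by
  ext j
  obtain rfl | h := eq_or_ne j i <;> simp [*]

lemma basisMap_mulVec {f : Qubits w → Qubits w} (hf : Function.Involutive f)
    (g : Qubits w → ℂ) : basisMap f *ᵥ g = fun a => g (f a) := by
  ext a
  simp [Matrix.mulVec, dotProduct, basisMap, ← hf.eq_iff]

lemma involutive_add_single (i : Fin w) {h : Qubits w → Bool}
    (hh : ∀ a c, h (a + Pi.single i c) = h a) :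
    Function.Involutive fun a => a + Pi.single i (h a) := fun a => by
  simp only [hh, boolVec_add_cancel_right]

lemma proj_mulVec (i : Fin w) (b : Bool) (g : Qubits w → ℂ) :
    proj i b *ᵥ g = fun a => if a i = b then g a else 0 := by
  ext a
  simp [proj, Matrix.mulVec_diagonal]

namespace Gate

lemma toMatrix_not (i : Fin w) :
    (not i).toMatrix = basisMap fun a => a + Pi.single i 1 := by
  simp only [toMatrix, ← update_add_single]
  simp [Bool.add_eq_xor, Bool.one_eq_true]

lemma toMatrix_cnot {i j : Fin w} (hij : i ≠ j) :
    (cnot i j hij).toMatrix = basisMap fun a => a + Pi.single j (a i) := by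
  simp only [toMatrix, ← update_add_single, Bool.add_eq_xor]

lemma toMatrix_toffoli {i j k : Fin w} (hij : i ≠ j) (hik : i ≠ k) (hjk : j ≠ k) :
    (toffoli i j k hij hik hjk).toMatrix =
      basisMap fun a => a + Pi.single k (a i * a j : Bool) := by
  simp only [toMatrix, ← update_add_single, Bool.add_eq_xor, Bool.mul_eq_and]

lemma involutive_not (i : Fin w) : Function.Involutive fun a : Qubits w => a + Pi.single i 1 :=
  involutive_add_single i fun _ _ => rfl

lemma involutive_cnot {i j : Fin w} (hij : i ≠ j) :
    Function.Involutive fun a : Qubits w => a + Pi.single j (a i) :=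
  involutive_add_single j fun _ _ => by simp [hij]

lemma involutive_toffoli {i j k : Fin w} (hik : i ≠ k) (hjk : j ≠ k) :
    Function.Involutive fun a : Qubits w => a + Pi.single k (a i * a j : Bool) :=
  involutive_add_single k fun _ _ => by simp [hik, hjk]

lemma not_mulVec (i : Fin w) (g : Qubits w → ℂ) :
    (not i).toMatrix *ᵥ g = fun a => g (a + Pi.single i 1) := by
  rw [toMatrix_not, basisMap_mulVec (involutive_not i)]

lemma cnot_mulVec {i j : Fin w} (hij : i ≠ j) (g : Qubits w → ℂ) :
    (cnot i j hij).toMatrix *ᵥ g = fun a => g (a + Pi.single j (a i)) := by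
  rw [toMatrix_cnot, basisMap_mulVec (involutive_cnot hij)]

lemma toffoli_mulVec {i j k : Fin w} (hij : i ≠ j) (hik : i ≠ k) (hjk : j ≠ k)
    (g : Qubits w → ℂ) : (toffoli i j k hij hik hjk).toMatrix *ᵥ g =
      fun a => g (a + Pi.single k (a i * a j : Bool)) := by
  rw [toMatrix_toffoli, basisMap_mulVec (involutive_toffoli hik hjk)]

lemma had_mulVec (i : Fin w) (g : Qubits w → ℂ) :
    (had i).toMatrix *ᵥ g = fun a =>
      ((1 / √2 : ℝ) : ℂ) * ∑ c, sgn (a i * c) * g (Function.update a i c) := by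
  ext a
  have hinj : Function.Injective (Function.update a i) := Function.update_injective a i
  rw [Finset.mul_sum, Matrix.mulVec, dotProduct]
  symm
  refine Finset.sum_of_injOn (Function.update a i) hinj.injOn (by simp) ?_ ?_
  · intro x _ hx
    have hoff : ¬ ∀ j, j ≠ i → a j = x j := fun h =>
      hx ⟨x i, by simp, Function.update_eq_iff.mpr ⟨rfl, h⟩⟩
    simp only [toMatrix, if_neg hoff, zero_mul]
  · intro c _
    have hoff : ∀ j, j ≠ i → a j = Function.update a i c j := fun j hj => by simp [hj]
    simp only [toMatrix, if_pos hoff, Function.update_self, sgn, Bool.mul_eq_and]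
    ring

end Gate

/-- The operator that applies the gates of the list from first to last. -/
noncomputable def circuit : List (Gate w) → Matrix (Qubits w) (Qubits w) ℂ
  | [] => 1
  | g :: gs => circuit gs * g.toMatrix

lemma circuit_append (gs hs : List (Gate w)) : circuit (gs ++ hs) = circuit hs * circuit gs := by
  induction gs with
  | nil => simp [circuit]
  | cons g gs ih => simp [circuit, ih, Matrix.mul_assoc]

lemma apply_add_list_sum {M β : Type*} [AddMonoid M] {f : M → β} {l : List M}
    (hl : ∀ x ∈ l, ∀ a, f (a + x) = f a) (a : M) : f (a + l.sum) = f a := by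
  induction l generalizing a with
  | nil => simp
  | cons x l ih =>
    rw [List.forall_mem_cons] at hl
    rw [List.sum_cons, ← add_assoc, ih hl.2, hl.1]

lemma circuit_flatMap_mulVec {G : κ → List (Gate w)} {t : κ → Fin w} {h : κ → Qubits w → Bool}
    (hG : ∀ k g, circuit (G k) *ᵥ g = fun a => g (a + Pi.single (t k) (h k a))) {ks : List κ}
    (hks : ks.Pairwise fun k k' => ∀ a c, h k (a + Pi.single (t k') c) = h k a)
    (g : Qubits w → ℂ) :
    circuit (ks.flatMap G) *ᵥ g =
      fun a => g (a + (ks.map fun k => Pi.single (t k) (h k a)).sum) := by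
  induction ks generalizing g with
  | nil => simp [circuit]
  | cons k ks ih =>
    obtain ⟨hk, hks⟩ := List.pairwise_cons.mp hks
    have unchanged (a : Qubits w) (f : κ → Bool) :
        h k (a + (ks.map fun k' => Pi.single (t k') (f k')).sum) = h k a :=
      apply_add_list_sum (by simpa using fun k' hk' a => hk k' hk' a (f k')) a
    ext a
    rw [List.flatMap_cons, circuit_append, ← Matrix.mulVec_mulVec, hG, ih hks]
    simp only [unchanged, List.map_cons, List.sum_cons]
    rw [add_right_comm, add_assoc]

end Circuits

/-! ### Outcomes of a program -/

lemma conj_mul_conjTranspose {m n : Type*} [Fintype m] [Fintype n] (A : Matrix m m ℂ)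
    (B : Matrix m n ℂ) : A * (B * Bᴴ) * Aᴴ = A * B * (A * B)ᴴ := by
  simp only [Matrix.conjTranspose_mul, Matrix.mul_assoc]

section Outcomes

variable {w : ℕ} {X : Type*}

lemma localOp_alice_mul_apply (U V : Matrix (Qubits w) (Qubits w) ℂ)
    (ψ : Matrix (Qubits w × Qubits w) X ℂ) (a b : Qubits w) (x : X) :
    (localOp .alice U V * ψ) (a, b) x =
      (U *ᵥ fun a' => (V *ᵥ fun b' => ψ (a', b') x) b) a := by
  simp [localOp, Matrix.mul_apply, Matrix.mulVec, dotProduct, Fintype.sum_prod_type,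
    Finset.mul_sum, mul_assoc]

lemma localOp_bob (U V : Matrix (Qubits w) (Qubits w) ℂ) :
    localOp .bob U V = localOp .alice V U := rfl

lemma localOp_mul (P : Party) (U V U' V' : Matrix (Qubits w) (Qubits w) ℂ) :
    localOp P U V * localOp P U' V' = localOp P (U * U') (V * V') := by
  cases P <;> exact (Matrix.mul_kronecker_mul _ _ _ _).symm

/-- The operator of the step `Step.send P i j` with measurement outcome `y`. -/
noncomputable def sendOp (P : Party) (i j : Fin w) (y : Bool) : JointOp w :=
  localOp P (proj i y) (if y then (Gate.not j).toMatrix else 1)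

lemma sendOp_alice_mul_apply (i j : Fin w) (y : Bool) (ψ : Matrix (Qubits w × Qubits w) X ℂ)
    (a b : Qubits w) (x : X) :
    (sendOp .alice i j y * ψ) (a, b) x =
      if a i = y then ψ (a, b + Pi.single j y) x else 0 := by
  rw [sendOp, localOp_alice_mul_apply, proj_mulVec]
  cases y <;> simp [Gate.not_mulVec, ← Bool.zero_eq_false, ← Bool.one_eq_true]

lemma sendOp_bob_mul_apply (i j : Fin w) (y : Bool) (ψ : Matrix (Qubits w × Qubits w) X ℂ)
    (a b : Qubits w) (x : X) :
    (sendOp .bob i j y * ψ) (a, b) x =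
      if b i = y then ψ (a + Pi.single j y, b) x else 0 := by
  rw [sendOp, localOp_bob, localOp_alice_mul_apply]
  simp only [proj_mulVec]
  cases y <;> simp [Gate.not_mulVec, ← Bool.zero_eq_false, ← Bool.one_eq_true]

variable [Fintype X]

/-- The final states of a program that starts in the pure-state ensemble whose `x`-th
unnormalized vector is the column `ψ · x`. -/
noncomputable def outcomes (l : List (Step w)) (ψ : Matrix (Qubits w × Qubits w) X ℂ) :
    Multiset (JointOp w) := branches l (ψ * ψᴴ)

lemma outcomes_nil (ψ : Matrix (Qubits w × Qubits w) X ℂ) : outcomes [] ψ = {ψ * ψᴴ} := rfl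

lemma outcomes_cons (s : Step w) (l : List (Step w)) (ψ : Matrix (Qubits w × Qubits w) X ℂ) :
    outcomes (s :: l) ψ = (s.ops.map fun A => outcomes l (A * ψ)).sum := by
  simp only [outcomes, branches, conj_mul_conjTranspose]
  induction s.ops with
  | nil => rfl
  | cons A As ih => rw [List.flatMap_cons, ← Multiset.coe_add, ih, List.map_cons, List.sum_cons]

lemma outcomes_gate_cons (P : Party) (g : Gate w) (l : List (Step w))
    (ψ : Matrix (Qubits w × Qubits w) X ℂ) :
    outcomes (.gate P g :: l) ψ = outcomes l (localOp P g.toMatrix 1 * ψ) := by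
  simp [outcomes_cons, Step.ops]

lemma outcomes_gates_append (P : Party) (gs : List (Gate w)) (l : List (Step w))
    (ψ : Matrix (Qubits w × Qubits w) X ℂ) :
    outcomes (gs.map (.gate P) ++ l) ψ = outcomes l (localOp P (circuit gs) 1 * ψ) := by
  induction gs generalizing ψ with
  | nil => cases P <;> simp [circuit, localOp]
  | cons g gs ih =>
    rw [List.map_cons, List.cons_append, outcomes_gate_cons, ih, ← Matrix.mul_assoc, localOp_mul,
      circuit, Matrix.mul_one]

/-- Both parties run the same gates. -/
def bilateral (gs : List (Gate w)) : List (Step w) :=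
  gs.flatMap fun g => [.gate .alice g, .gate .bob g]

lemma length_bilateral (gs : List (Gate w)) : (bilateral gs).length = 2 * gs.length := by
  simp [bilateral, mul_comm]

lemma outcomes_bilateral_append (gs : List (Gate w)) (l : List (Step w))
    (ψ : Matrix (Qubits w × Qubits w) X ℂ) :
    outcomes (bilateral gs ++ l) ψ = outcomes l (localOp .alice (circuit gs) (circuit gs) * ψ) := by
  induction gs generalizing ψ with
  | nil => simp [bilateral, circuit, localOp]
  | cons g gs ih =>
    rw [bilateral, List.flatMap_cons, List.append_assoc, ← bilateral, List.cons_append,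
      List.cons_append, List.nil_append, outcomes_gate_cons, outcomes_gate_cons, ih, localOp_bob,
      ← Matrix.mul_assoc, localOp_mul, ← Matrix.mul_assoc, localOp_mul, circuit, Matrix.mul_one,
      Matrix.mul_one]

lemma outcomes_send_cons (P : Party) (i j : Fin w) (l : List (Step w))
    (ψ : Matrix (Qubits w × Qubits w) X ℂ) :
    outcomes (.send P i j :: l) ψ = ∑ y : Bool,
      outcomes l (sendOp P i j y * ψ) := by
  simp [outcomes_cons, Step.ops, sendOp, add_comm]

end Outcomes

lemma sum_finset_eq_sum_boolVec {κ M : Type*} [Fintype κ] [DecidableEq κ] [AddCommMonoid M]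
    (f : (κ → Bool) → M) : ∑ S : Finset κ, f (fun k => decide (k ∈ S)) = ∑ R, f R :=
  Fintype.sum_bijective (fun (S : Finset κ) k => decide (k ∈ S))
    ⟨fun S S' h => by ext k; simpa using congrFun h k,
      fun R => ⟨Finset.univ.filter fun k => R k, by ext k; simp⟩⟩ _ _ fun _ => rfl

section Families

variable {w : ℕ} {X κ : Type*}

/-- Alice tosses a fair coin with her qubit `i` and both parties keep the result on their
qubits `i`. -/
def shareBit (i : Fin w) : List (Step w) := [.gate .alice (.had i), .send .alice i i]

/-- The basis label with a `1` exactly on the wires `f k` for `k ∈ S`. -/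
def mark (f : κ → Fin w) (S : Finset κ) : Qubits w := ∑ k ∈ S, Pi.single (f k) 1

lemma mark_insert [DecidableEq κ] (f : κ → Fin w) {S : Finset κ} {k : κ} (hk : k ∉ S) :
    mark f (insert k S) = Pi.single (f k) 1 + mark f S := Finset.sum_insert hk

lemma mark_apply [DecidableEq κ] {f : κ → Fin w} (hf : f.Injective) (S : Finset κ) (k : κ) :
    mark f S (f k) = decide (k ∈ S) := by
  simp only [mark, Finset.sum_apply, Pi.single_apply, hf.eq_iff, Finset.sum_ite_eq]
  rfl

lemma mark_apply_of_notMem_range {f : κ → Fin w} {i : Fin w} (hi : i ∉ Set.range f)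
    (S : Finset κ) : mark f S i = 0 := by
  rw [mark, Finset.sum_apply]
  exact Finset.sum_eq_zero fun k _ => Pi.single_eq_of_ne (fun h => hi ⟨k, h.symm⟩) _

variable [Fintype X]

lemma outcomes_shareBit_append {i : Fin w} {ψ : Matrix (Qubits w × Qubits w) X ℂ}
    (hψ : ∀ a b x, a i ≠ 0 → ψ (a, b) x = 0) (l : List (Step w)) :
    outcomes (shareBit i ++ l) ψ = ∑ y : Bool, outcomes l
      (((1 / √2 : ℝ) : ℂ) • ψ.submatrix (· + (Pi.single i y, Pi.single i y)) id) := by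
  rw [shareBit, List.cons_append, List.cons_append, List.nil_append, outcomes_gate_cons,
    outcomes_send_cons]
  refine Finset.sum_congr rfl fun y _ => congrArg _ ?_
  ext ⟨a, b⟩ x
  rw [sendOp_alice_mul_apply, localOp_alice_mul_apply, Gate.had_mulVec]
  split_ifs with hy
  · have hzero : Function.update a i 0 = a + Pi.single i y := by
      rw [← update_add_single, hy, BooleanRing.add_self]
    have hone : ψ (Function.update a i 1, b + Pi.single i y) x = 0 := hψ _ _ _ (by simp)
    simp [← Bool.zero_eq_false, ← Bool.one_eq_true, hzero, hone, sgn_zero]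
  · have hzero : ψ (a + Pi.single i y, b + Pi.single i y) x = 0 := hψ _ _ _ <| by
      rw [Pi.add_apply, Pi.single_eq_same, Ne, BooleanRing.add_eq_zero']
      exact hy
    simp [hzero]

lemma outcomes_shareBits_append [DecidableEq κ] {f : κ → Fin w} (hf : f.Injective) {ks : List κ}
    (hks : ks.Nodup) {ψ : Matrix (Qubits w × Qubits w) X ℂ}
    (hψ : ∀ k ∈ ks, ∀ a b x, a (f k) ≠ 0 → ψ (a, b) x = 0) (l : List (Step w)) :
    outcomes (ks.flatMap (fun k => shareBit (f k)) ++ l) ψ = ∑ S ∈ ks.toFinset.powerset,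
      outcomes l (((1 / √2 : ℝ) : ℂ) ^ ks.length •
        ψ.submatrix (· + (mark f S, mark f S)) id) := by
  induction ks generalizing ψ with
  | nil =>
    have : (fun q : Qubits w × Qubits w => q + (0, 0)) = id := funext add_zero
    simp [mark, this]
  | cons k ks ih =>
    obtain ⟨hk, hks⟩ := List.nodup_cons.mp hks
    rw [List.forall_mem_cons] at hψ
    rw [List.flatMap_cons, List.append_assoc, outcomes_shareBit_append hψ.1, List.toFinset_cons,
      Finset.sum_powerset_insert (by simpa using hk)]
    have hrest (y : Bool) := ih (ψ := ((1 / √2 : ℝ) : ℂ) •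
        ψ.submatrix (· + (Pi.single (f k) y, Pi.single (f k) y)) id) hks
      fun k' hk' a b x ha => by
        have hne : f k' ≠ f k := hf.ne (ne_of_mem_of_not_mem hk' hk)
        simp [hψ.2 k' hk' (a + Pi.single (f k) y) _ x (by simpa [hne] using ha)]
    simp only [hrest, Fintype.sum_bool]
    rw [add_comm]
    congr 1 <;> refine Finset.sum_congr rfl fun S hS => congrArg _ ?_
    · ext q x
      simp [pow_succ, mul_assoc, ← Bool.zero_eq_false, ← Prod.zero_eq_mk]
    · have hkS : k ∉ S := fun h => hk (by simpa using Finset.mem_powerset.mp hS h)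
      ext q x
      simp [pow_succ, mul_assoc, mark_insert f hkS, add_assoc, ← Bool.one_eq_true, add_comm]

/-- Party `bob` measures his qubits `f k` and sends the results, which Alice adds to her
qubits `f k`. -/
def exchange (f : κ → Fin w) (ks : List κ) : List (Step w) :=
  ks.map fun k => .send .bob (f k) (f k)

lemma outcomes_exchange_append [DecidableEq κ] (f : κ → Fin w) {ks : List κ} (hks : ks.Nodup)
    (ψ : Matrix (Qubits w × Qubits w) X ℂ) (l : List (Step w)) :
    outcomes (exchange f ks ++ l) ψ = ∑ S ∈ ks.toFinset.powerset, outcomes l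
      (Matrix.of fun q x =>
        if ∀ k ∈ ks, q.2 (f k) = decide (k ∈ S) then ψ (q.1 + mark f S, q.2) x else 0) := by
  induction ks generalizing ψ with
  | nil => simp [exchange, mark]; rfl
  | cons k ks ih =>
    obtain ⟨hk, hks⟩ := List.nodup_cons.mp hks
    rw [exchange, List.map_cons, List.cons_append, ← exchange, outcomes_send_cons,
      List.toFinset_cons, Finset.sum_powerset_insert (by simpa using hk), Fintype.sum_bool,
      add_comm, ih hks, ih hks]
    congr 1 <;> refine Finset.sum_congr rfl fun S hS => congrArg _ ?_ <;>
      have hkS : k ∉ S := fun h => hk (by simpa using Finset.mem_powerset.mp hS h)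
    · ext ⟨a, b⟩ x
      simp only [Matrix.of_apply, sendOp_bob_mul_apply]
      simp only [List.forall_mem_cons, hkS, decide_false, ← Bool.zero_eq_false, Pi.single_zero,
        add_zero, ite_and]
      split_ifs <;> rfl
    · have hmem : ∀ k' ∈ ks, decide (k' ∈ insert k S) = decide (k' ∈ S) := fun k' hk' => by
        simp [ne_of_mem_of_not_mem hk' hk]
      ext ⟨a, b⟩ x
      simp only [Matrix.of_apply, sendOp_bob_mul_apply, mark_insert f hkS]
      simp +contextual only [List.forall_mem_cons, Finset.mem_insert_self, decide_true, hmem,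
        ← Bool.one_eq_true, ite_and, ← add_assoc, add_right_comm]
      split_ifs <;> rfl

end Families

/-! ### Conservation of probability -/

section Conservation

variable {w : ℕ}

lemma basisMap_conjTranspose_mul_self {f : Qubits w → Qubits w} (hf : f.Injective) :
    (basisMap f)ᴴ * basisMap f = 1 := by
  ext a b
  simp [basisMap, Matrix.mul_apply, Matrix.one_apply, hf.eq_iff, eq_comm]

lemma proj_conjTranspose_mul_self (i : Fin w) (b : Bool) : (proj i b)ᴴ * proj i b = proj i b := by
  simp only [proj, Matrix.diagonal_conjTranspose, Matrix.diagonal_mul_diagonal]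
  congr 1
  ext a
  split_ifs <;> simp [*]

lemma proj_false_add_proj_true (i : Fin w) : proj i false + proj i true = 1 := by
  rw [proj, proj, Matrix.diagonal_add, ← Matrix.diagonal_one]
  congr 1
  ext a
  cases a i <;> simp

namespace Gate

lemma had_apply (i : Fin w) (a b : Qubits w) : (had i).toMatrix a b =
    if ∀ j, j ≠ i → a j = b j then
      (if (a i && b i) = true then -1 else 1) * ((1 / √2 : ℝ) : ℂ) else 0 := rfl

lemma had_mul_self (i : Fin w) : (had i).toMatrix * (had i).toMatrix = 1 := by
  rw [Matrix.ext_iff_mulVec]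
  intro g
  have hsqrt : (√2 : ℂ)⁻¹ * (√2 : ℂ)⁻¹ = 2⁻¹ := by
    rw [← mul_inv, ← Complex.ofReal_mul, Real.mul_self_sqrt zero_le_two]; simp
  ext a
  have hself : Function.update a i (a i) = a := Function.update_eq_self i a
  rw [← Matrix.mulVec_mulVec, had_mulVec, had_mulVec, Matrix.one_mulVec]
  cases h : a i <;> rw [h] at hself <;> simp [h, sgn, Bool.mul_eq_and, hself] <;>
    linear_combination 2 * g a * hsqrt

lemma conjTranspose_toMatrix_mul_self (g : Gate w) : g.toMatrixᴴ * g.toMatrix = 1 := by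
  cases g with
  | not i => rw [toMatrix_not]; exact basisMap_conjTranspose_mul_self (involutive_not i).injective
  | had i =>
    have hherm : (had i).toMatrixᴴ = (had i).toMatrix := by
      ext a b
      rw [Matrix.conjTranspose_apply, had_apply, had_apply]
      simp only [eq_comm (a := b _), Bool.and_comm (b i)]
      split_ifs <;> simp
    rw [hherm, had_mul_self]
  | phase i =>
    rw [toMatrix, Matrix.diagonal_conjTranspose, Matrix.diagonal_mul_diagonal,
      ← Matrix.diagonal_one]
    congr 1
    ext a
    split_ifs with ha
    · simp only [Pi.star_apply, if_pos ha, RCLike.star_def, Complex.conj_mul',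
        Complex.norm_exp_I_mul_ofReal, Complex.ofReal_one, one_pow]
    · simp [ha]
  | cnot i j hij =>
    rw [toMatrix_cnot]; exact basisMap_conjTranspose_mul_self (involutive_cnot hij).injective
  | toffoli i j k hij hik hjk =>
    rw [toMatrix_toffoli]
    exact basisMap_conjTranspose_mul_self (involutive_toffoli hik hjk).injective

end Gate

lemma localOp_conjTranspose_mul_self (P : Party) (U V : Matrix (Qubits w) (Qubits w) ℂ) :
    (localOp P U V)ᴴ * localOp P U V = localOp P (Uᴴ * U) (Vᴴ * V) := by
  cases P <;> simp [localOp, Matrix.conjTranspose_kronecker, Matrix.mul_kronecker_mul]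

lemma localOp_one (P : Party) : localOp P (1 : Matrix (Qubits w) (Qubits w) ℂ) 1 = 1 := by
  cases P <;> exact Matrix.one_kronecker_one

lemma localOp_proj_add (P : Party) (i : Fin w) :
    localOp P (proj i false) 1 + localOp P (proj i true) 1 = 1 := by
  rw [← localOp_one P, ← proj_false_add_proj_true i]
  cases P
  · exact (Matrix.add_kronecker _ _ _).symm
  · exact (Matrix.kronecker_add _ _ _).symm

lemma Step.sum_conjTranspose_mul_ops (s : Step w) : (s.ops.map fun A => Aᴴ * A).sum = 1 := by
  cases s <;>
    simp [Step.ops, localOp_conjTranspose_mul_self, Gate.conjTranspose_toMatrix_mul_self,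
      proj_conjTranspose_mul_self, localOp_one, localOp_proj_add]

lemma trace_branches (l : List (Step w)) (σ : JointOp w) :
    ((branches l σ).map Matrix.trace).sum = σ.trace := by
  induction l generalizing σ with
  | nil => simp [branches]
  | cons s l ih =>
    have hops (As : List (JointOp w)) :
        ((As.flatMap fun A => branches l (A * σ * Aᴴ)).map Matrix.trace).sum =
          ((As.map fun A => Aᴴ * A).sum * σ).trace := by
      induction As with
      | nil => simp
      | cons A As ihA =>
        rw [List.flatMap_cons, List.map_append, List.sum_append, ih, ihA, List.map_cons,
          List.sum_cons, add_mul, Matrix.trace_add, Matrix.trace_mul_cycle A]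
    rw [branches, hops, s.sum_conjTranspose_mul_ops, one_mul]

end Conservation

/-! ### Fidelity and the output state -/

section Fidelity

lemma norm_sum_sq_le {ι E : Type*} [SeminormedAddCommGroup E] (s : Finset ι) (f : ι → E) :
    ‖∑ i ∈ s, f i‖ ^ 2 ≤ s.card * ∑ i ∈ s, ‖f i‖ ^ 2 :=
  calc ‖∑ i ∈ s, f i‖ ^ 2 ≤ (∑ i ∈ s, ‖f i‖) ^ 2 := by gcongr; exact norm_sum_le _ _
    _ ≤ s.card * ∑ i ∈ s, ‖f i‖ ^ 2 := sq_sum_le_card_mul_sum_sq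

/-- The squared norm of a family of unnormalized vectors, the columns of `A`: the probability of
the pure-state ensemble that they form. -/
noncomputable def weight {m n : Type*} [Fintype m] [Fintype n] (A : Matrix m n ℂ) : ℝ :=
  ∑ i, ∑ j, ‖A i j‖ ^ 2

lemma weight_nonneg {m n : Type*} [Fintype m] [Fintype n] (A : Matrix m n ℂ) : 0 ≤ weight A := by
  unfold weight; positivity

lemma trace_mul_conjTranspose {m n : Type*} [Fintype m] [Fintype n] (A : Matrix m n ℂ) :
    (A * Aᴴ).trace = weight A := by
  simp [Matrix.trace, Matrix.mul_apply, Complex.mul_conj', weight]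

lemma exists_eq_mul_conjTranspose {n : Type*} [Finite n] {A : Matrix n n ℂ}
    (hA : A.PosSemidef) : ∃ (k : ℕ) (B : Matrix n (Fin k) ℂ), A = B * Bᴴ := by
  obtain ⟨k, v, rfl⟩ := Matrix.posSemidef_iff_eq_sum_vecMulVec.mp hA
  refine ⟨k, Matrix.of fun i j => v j i, ?_⟩
  ext i j
  simp [Matrix.sum_apply, Matrix.mul_apply, Matrix.vecMulVec_apply]

variable {T : ℕ} {B X : Type*} [Fintype B] [Fintype X]

/-- The squared overlap of a family of bipartite vectors with the maximally entangled vector on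
the basis `B`. -/
noncomputable def overlap (A : Matrix (B × B) X ℂ) : ℝ :=
  (∑ x, ‖∑ i, A (i, i) x‖ ^ 2) / Fintype.card B

lemma overlap_nonneg (A : Matrix (B × B) X ℂ) : 0 ≤ overlap A := by
  unfold overlap; positivity

lemma overlap_le_weight (A : Matrix (B × B) X ℂ) : overlap A ≤ weight A := by
  refine div_le_of_le_mul₀ (Nat.cast_nonneg _) (weight_nonneg A) ?_
  calc ∑ x, ‖∑ i, A (i, i) x‖ ^ 2 ≤ ∑ x, Fintype.card B * ∑ i, ‖A (i, i) x‖ ^ 2 := by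
        gcongr with x
        exact norm_sum_sq_le _ _
    _ = (∑ i, ∑ x, ‖A (i, i) x‖ ^ 2) * Fintype.card B := by
        rw [← Finset.mul_sum, Finset.sum_comm, mul_comm]
    _ ≤ weight A * Fintype.card B := by
        rw [weight, Fintype.sum_prod_type]
        gcongr with i
        exact Finset.single_le_sum (f := fun j => ∑ x, ‖A (i, j) x‖ ^ 2)
          (fun j _ => by positivity) (Finset.mem_univ i)

lemma fidelity_mul_conjTranspose (A : Matrix (Fin T × Fin T) X ℂ) :
    fidelity (A * Aᴴ) = overlap A := by
  have hmul (x : X) : (Aᴴ *ᵥ maxEnt T) x = (1 / √T : ℝ) * star (∑ i, A (i, i) x) := by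
    simp [Matrix.mulVec, dotProduct, Fintype.sum_prod_type, maxEnt, Finset.mul_sum, mul_comm]
  have hstar : star (maxEnt T) ᵥ* A = star (Aᴴ *ᵥ maxEnt T) := by
    rw [Matrix.star_mulVec, Matrix.conjTranspose_conjTranspose]
  have hnorm (z : ℂ) : (star z * z).re = ‖z‖ ^ 2 := by
    rw [Complex.star_def, Complex.conj_mul', ← Complex.ofReal_pow, Complex.ofReal_re]
  rw [fidelity, overlap, Fintype.card_fin, ← Matrix.mulVec_mulVec, Matrix.dotProduct_mulVec, hstar,
    dotProduct, Complex.re_sum, Finset.sum_div]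
  refine Finset.sum_congr rfl fun x _ => ?_
  rw [Pi.star_apply, hnorm, hmul, norm_mul, norm_star, mul_pow, Complex.norm_real, Real.norm_eq_abs,
    sq_abs, div_pow, one_pow, Real.sq_sqrt (Nat.cast_nonneg T), one_div_mul_eq_div]

lemma fidelity_smul (c : ℝ) (A : Matrix (Fin T × Fin T) (Fin T × Fin T) ℂ) :
    fidelity (c • A) = c * fidelity A := by
  rw [fidelity, Matrix.smul_mulVec, dotProduct_smul, Complex.smul_re, smul_eq_mul, fidelity]

lemma fidelity_sum {κ : Type*} (s : Finset κ)
    (A : κ → Matrix (Fin T × Fin T) (Fin T × Fin T) ℂ) :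
    fidelity (∑ k ∈ s, A k) = ∑ k ∈ s, fidelity (A k) := by
  simp only [fidelity, Matrix.sum_mulVec, dotProduct_sum, Complex.re_sum]

lemma fidelity_le_trace {A : Matrix (Fin T × Fin T) (Fin T × Fin T) ℂ} (hA : A.PosSemidef) :
    fidelity A ≤ A.trace.re := by
  obtain ⟨k, C, rfl⟩ := exists_eq_mul_conjTranspose hA
  rw [fidelity_mul_conjTranspose, trace_mul_conjTranspose, Complex.ofReal_re]
  exact overlap_le_weight C

lemma fidelity_le_one {ρ : Matrix (Fin T × Fin T) (Fin T × Fin T) ℂ} (hρ : IsState ρ) :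
    fidelity ρ ≤ 1 := by
  simpa only [hρ.2, Complex.one_re] using fidelity_le_trace hρ.1

end Fidelity

lemma bits_injective {k N : ℕ} (hN : N ≤ 2 ^ k) :
    Function.Injective fun x : Fin N => bits k x := fun x y h => by
  refine Fin.ext (Nat.eq_of_testBit_eq fun i => ?_)
  by_cases hi : i < k
  · exact congrFun h ⟨i, hi⟩
  · have hle : N ≤ 2 ^ i := hN.trans (Nat.pow_le_pow_right two_pos (not_lt.mp hi))
    rw [Nat.testBit_lt_two_pow (x.2.trans_le hle), Nat.testBit_lt_two_pow (y.2.trans_le hle)]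

lemma bits_clog_injective (N : ℕ) : Function.Injective fun x : Fin N => bits (Nat.clog 2 N) x :=
  bits_injective (Nat.le_pow_clog one_lt_two N)

namespace Protocol

section ReadOut

variable {N K M : ℕ} (P : Protocol N K M)

/-- The values of one party's discarded wires. -/
abbrev Rest : Type := {i // i ∉ Set.range P.outWire} → Bool

/-- The part of a basis label that is discarded. -/
def rest (a : Qubits P.width) : P.Rest := fun i => a i

/-- The basis label with the number `x` on the output wires and `e` on the discarded wires. -/
noncomputable def assemble (e : P.Rest) (x : Fin M) : Qubits P.width :=
  Function.extend P.outWire (bits (Nat.clog 2 M) x) (Function.extend Subtype.val e 0)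

/-- The pair of labels that both parties obtain by `Protocol.assemble`. -/
noncomputable def outLabel (d : P.Rest × P.Rest) (r : Fin M × Fin M) :
    Qubits P.width × Qubits P.width := (P.assemble d.1 r.1, P.assemble d.2 r.2)

variable {P}

lemma reads_assemble (e : P.Rest) (x : Fin M) : P.Reads (P.assemble e x) x := fun i =>
  P.outWire.injective.extend_apply _ _ i

lemma rest_assemble (e : P.Rest) (x : Fin M) : P.rest (P.assemble e x) = e := by
  ext i
  rw [rest, assemble, Function.extend_apply' _ _ _ i.2, Subtype.val_injective.extend_apply]

lemma assemble_rest {a : Qubits P.width} {x : Fin M} (ha : P.Reads a x) :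
    P.assemble (P.rest a) x = a := by
  ext i
  by_cases hi : i ∈ Set.range P.outWire
  · obtain ⟨j, rfl⟩ := hi
    rw [reads_assemble, ha]
  · exact congrFun (rest_assemble (P.rest a) x) ⟨i, hi⟩

lemma assemble_injective2 : Function.Injective2 P.assemble := fun e e' x x' h => by
  refine ⟨by rw [← rest_assemble e x, h, rest_assemble], bits_clog_injective M ?_⟩
  exact funext fun i => by
    simpa only [reads_assemble _ _ i] using congrFun h (P.outWire i)

lemma outLabel_injective2 : Function.Injective2 P.outLabel := fun _ _ _ _ h =>
  have h₁ := assemble_injective2 (Prod.ext_iff.mp h).1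
  have h₂ := assemble_injective2 (Prod.ext_iff.mp h).2
  ⟨Prod.ext h₁.1 h₂.1, Prod.ext h₁.2 h₂.2⟩

lemma reads_and_agreeOff_iff {a a' : Qubits P.width} {x x' : Fin M} :
    (P.Reads a x ∧ P.Reads a' x' ∧ P.AgreeOff a a') ↔
      ∃ e, a = P.assemble e x ∧ a' = P.assemble e x' := by
  constructor
  · rintro ⟨hx, hx', h⟩
    have hrest : P.rest a = P.rest a' := funext fun i => h i i.2
    exact ⟨P.rest a, (assemble_rest hx).symm, by rw [hrest, assemble_rest hx']⟩
  · rintro ⟨e, rfl, rfl⟩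
    refine ⟨reads_assemble e x, reads_assemble e x', fun i hi => ?_⟩
    exact congrFun ((rest_assemble e x).trans (rest_assemble e x').symm) ⟨i, hi⟩

lemma readOut_eq_sum (σ : JointOp P.width) :
    P.readOut σ = ∑ d, σ.submatrix (P.outLabel d) (P.outLabel d) := by
  classical
  have hcond (q q' : Qubits P.width × Qubits P.width) (r s : Fin M × Fin M) :
      (P.Reads q.1 r.1 ∧ P.Reads q.2 r.2 ∧ P.Reads q'.1 s.1 ∧ P.Reads q'.2 s.2 ∧
        P.AgreeOff q.1 q'.1 ∧ P.AgreeOff q.2 q'.2) ↔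
      ∃ d, q = P.outLabel d r ∧ q' = P.outLabel d s := by
    have h₁ := reads_and_agreeOff_iff (P := P) (a := q.1) (a' := q'.1) (x := r.1) (x' := s.1)
    have h₂ := reads_and_agreeOff_iff (P := P) (a := q.2) (a' := q'.2) (x := r.2) (x' := s.2)
    simp only [Prod.exists, Prod.ext_iff, outLabel]
    grind
  have hunique (q q' : Qubits P.width × Qubits P.width) (r s : Fin M × Fin M) :
      (if ∃ d, q = P.outLabel d r ∧ q' = P.outLabel d s then σ q q' else 0) =
        ∑ d, if q = P.outLabel d r ∧ q' = P.outLabel d s then σ q q' else 0 := by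
    split_ifs with h
    · obtain ⟨d, rfl, rfl⟩ := h
      rw [Finset.sum_eq_single d _ (by simp), if_pos ⟨rfl, rfl⟩]
      exact fun d' _ hd' => if_neg fun h => hd' (outLabel_injective2 h.1).1.symm
    · exact (Finset.sum_eq_zero fun d _ => if_neg fun hd => h ⟨d, hd⟩).symm
  ext r s
  simp only [readOut, hcond, hunique, Matrix.sum_apply, Matrix.submatrix_apply]
  rw [Finset.sum_congr rfl fun q _ => Finset.sum_comm, Finset.sum_comm]
  simp [ite_and]

lemma posSemidef_readOut {σ : JointOp P.width} (hσ : σ.PosSemidef) :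
    (P.readOut σ).PosSemidef := by
  rw [readOut_eq_sum]
  exact Matrix.posSemidef_sum _ fun d _ => hσ.submatrix _

lemma trace_readOut {σ : JointOp P.width}
    (hσ : ∀ q, σ q q ≠ 0 → ∃ r : Fin M × Fin M, P.Reads q.1 r.1 ∧ P.Reads q.2 r.2) :
    (P.readOut σ).trace = σ.trace := by
  rw [readOut_eq_sum, Matrix.trace_sum]
  simp only [Matrix.trace, Matrix.diag_apply, Matrix.submatrix_apply]
  rw [← Fintype.sum_prod_type']
  refine Fintype.sum_of_injective _ outLabel_injective2.uncurry _ _ (fun q hq => ?_) fun _ => rfl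
  by_contra h
  obtain ⟨r, h₁, h₂⟩ := hσ q h
  exact hq ⟨((P.rest q.1, P.rest q.2), r), Prod.ext (assemble_rest h₁) (assemble_rest h₂)⟩

lemma sum_overlap_le_fidelity_readOut {X Z : Type*} [Fintype X] [Fintype Z]
    {d : Z → P.Rest × P.Rest} (hd : d.Injective)
    (Φ : Matrix (Qubits P.width × Qubits P.width) X ℂ) :
    ∑ z, overlap (Φ.submatrix (P.outLabel (d z)) id) ≤ fidelity (P.readOut (Φ * Φᴴ)) := by
  have hpure (e : P.Rest × P.Rest) : fidelity ((Φ * Φᴴ).submatrix (P.outLabel e) (P.outLabel e)) =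
      overlap (Φ.submatrix (P.outLabel e) id) :=
    fidelity_mul_conjTranspose (Φ.submatrix (P.outLabel e) id)
  rw [readOut_eq_sum, fidelity_sum]
  simp only [hpure]
  refine (Finset.sum_map .univ ⟨d, hd⟩ fun e =>
    overlap (Φ.submatrix (P.outLabel e) id)).symm.trans_le ?_
  exact Finset.sum_le_sum_of_subset_of_nonneg (Finset.subset_univ _) fun e _ _ => overlap_nonneg _

end ReadOut

end Protocol

lemma mul_sum_sub_sum_filter_le {S : Type*} (s : Finset S) {p g : S → ℝ} (δ : ℝ)
    (hp : ∀ i, 0 ≤ p i) (hg : ∀ i, g i ≤ p i) :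
    δ * (∑ i ∈ s, p i - ∑ i ∈ s with 1 - δ ≤ (p i)⁻¹ * g i, p i) ≤ ∑ i ∈ s, (p i - g i) := by
  rw [Finset.sum_filter, ← Finset.sum_sub_distrib, Finset.mul_sum]
  refine Finset.sum_le_sum fun i _ => ?_
  obtain h | h := (hp i).eq_or_lt
  · simpa [← h] using hg i
  · split_ifs with hδ
    · simpa using hg i
    · rw [not_le, inv_mul_lt_iff₀ h] at hδ
      linarith

namespace Protocol

section Probability

variable {N K M : ℕ} {X : Type*} (P : Protocol N K M)

/-- The component of the vectors `ψ` in which Alice's qubit `failWire` has the value `b`. -/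
noncomputable def branch (b : Bool) (ψ : Matrix (Qubits P.width × Qubits P.width) X ℂ) :
    Matrix (Qubits P.width × Qubits P.width) X ℂ := localOp .alice (proj P.failWire b) 1 * ψ

lemma branch_apply (b : Bool) (ψ : Matrix (Qubits P.width × Qubits P.width) X ℂ)
    (q : Qubits P.width × Qubits P.width) (x : X) :
    P.branch b ψ q x = if q.1 P.failWire = b then ψ q x else 0 := by
  obtain ⟨a, b⟩ := q
  simp [branch, localOp_alice_mul_apply, proj_mulVec]

variable [Fintype X]

lemma weight_branch_add (ψ : Matrix (Qubits P.width × Qubits P.width) X ℂ) :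
    weight (P.branch true ψ) + weight (P.branch false ψ) = weight ψ := by
  simp only [weight, ← Finset.sum_add_distrib, branch_apply]
  refine Finset.sum_congr rfl fun q _ => Finset.sum_congr rfl fun x _ => ?_
  cases q.1 P.failWire <;> simp

/-- The unnormalized output state in the case of success. -/
noncomputable def output (ψ : Matrix (Qubits P.width × Qubits P.width) X ℂ) :
    Matrix (Fin M × Fin M) (Fin M × Fin M) ℂ :=
  P.readOut (P.branch false ψ * (P.branch false ψ)ᴴ)

lemma finish_mul_conjTranspose (ψ : Matrix (Qubits P.width × Qubits P.width) X ℂ) :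
    P.finish (ψ * ψᴴ) = [(weight (P.branch true ψ), none),
      (weight (P.branch false ψ), some (((weight (P.branch false ψ))⁻¹ : ℝ) • P.output ψ))] := by
  simp only [finish, conj_mul_conjTranspose, branch, trace_mul_conjTranspose, Complex.ofReal_re,
    output, ← Complex.ofReal_inv, Complex.coe_smul]

variable {S : Type*} [Fintype S]

/-- The final states of the protocol on the input `ρ` are the pure-state ensembles `Ω s`, one for
each sequence `s` of measurement outcomes. -/
def HasBranches (ρ : Matrix (Fin N × Fin N) (Fin N × Fin N) ℂ)
    (Ω : S → Matrix (Qubits P.width × Qubits P.width) X ℂ) : Prop :=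
  (branches P.program (P.initial ρ) : Multiset (JointOp P.width)) =
    Finset.univ.val.map fun s => Ω s * (Ω s)ᴴ

variable {P} {ρ : Matrix (Fin N × Fin N) (Fin N × Fin N) ℂ}
  {Ω : S → Matrix (Qubits P.width × Qubits P.width) X ℂ}

lemma results_eq (hΩ : P.HasBranches ρ Ω) :
    (P.results ρ : Multiset _) = Finset.univ.val.bind fun s =>
      {(weight (P.branch true (Ω s)), none), (weight (P.branch false (Ω s)),
        some (((weight (P.branch false (Ω s)))⁻¹ : ℝ) • P.output (Ω s)))} := by
  rw [results, ← Multiset.coe_bind, hΩ, Multiset.bind_map]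
  simp only [finish_mul_conjTranspose]
  rfl

lemma prob_ne_none (hΩ : P.HasBranches ρ Ω) :
    P.prob ρ (fun r => r ≠ none) = ∑ s, weight (P.branch false (Ω s)) := by
  rw [prob, ← Multiset.sum_coe, ← Multiset.map_coe, results_eq hΩ, Multiset.map_bind,
    Multiset.sum_bind]
  simp

lemma prob_eq_none (hΩ : P.HasBranches ρ Ω) :
    P.prob ρ (fun r => r = none) = (P.initial ρ).trace.re - P.prob ρ (fun r => r ≠ none) := by
  have htrace : (∑ s, weight (Ω s) : ℝ) = (P.initial ρ).trace := by
    rw [← trace_branches P.program, ← Multiset.sum_coe, ← Multiset.map_coe, hΩ]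
    simp [trace_mul_conjTranspose]
  have hnone : P.prob ρ (fun r => r = none) = ∑ s, weight (P.branch true (Ω s)) := by
    rw [prob, ← Multiset.sum_coe, ← Multiset.map_coe, results_eq hΩ, Multiset.map_bind,
      Multiset.sum_bind]
    simp
  rw [hnone, prob_ne_none hΩ, ← htrace, Complex.ofReal_re, eq_sub_iff_add_eq,
    ← Finset.sum_add_distrib]
  simp only [weight_branch_add]

lemma prob_fidelity_ge (hΩ : P.HasBranches ρ Ω) (η : ℝ) :
    P.prob ρ (fun r => ∃ τ, r = some τ ∧ η ≤ fidelity τ) =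
      ∑ s with η ≤ (weight (P.branch false (Ω s)))⁻¹ * fidelity (P.output (Ω s)),
        weight (P.branch false (Ω s)) := by
  rw [prob, ← Multiset.sum_coe, ← Multiset.map_coe, results_eq hΩ, Multiset.map_bind,
    Multiset.sum_bind, Finset.sum_filter]
  simp [← fidelity_smul]

variable (P) in
/-- No final vector of a successful run has weight outside the encoded output space. -/
def Readable (ψ : Matrix (Qubits P.width × Qubits P.width) X ℂ) : Prop :=
  ∀ q x, P.branch false ψ q x ≠ 0 → ∃ r : Fin M × Fin M, P.Reads q.1 r.1 ∧ P.Reads q.2 r.2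

lemma posSemidef_output (ψ : Matrix (Qubits P.width × Qubits P.width) X ℂ) :
    (P.output ψ).PosSemidef := posSemidef_readOut (Matrix.posSemidef_self_mul_conjTranspose _)

lemma trace_output {ψ : Matrix (Qubits P.width × Qubits P.width) X ℂ} (hψ : P.Readable ψ) :
    (P.output ψ).trace = weight (P.branch false ψ) := by
  rw [output, trace_readOut, trace_mul_conjTranspose]
  intro q hq
  rw [Matrix.mul_apply] at hq
  obtain ⟨x, -, hx⟩ := Finset.exists_ne_zero_of_sum_ne_zero hq
  exact hψ q x (left_ne_zero_of_mul hx)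

lemma fidelity_output_le {ψ : Matrix (Qubits P.width × Qubits P.width) X ℂ}
    (hψ : P.Readable ψ) : fidelity (P.output ψ) ≤ weight (P.branch false ψ) := by
  rw [← Complex.ofReal_re (weight _), ← trace_output hψ]
  exact fidelity_le_trace (posSemidef_output ψ)

lemma isState_of_mem_results (hΩ : P.HasBranches ρ Ω) (hread : ∀ s, P.Readable (Ω s))
    {r : Result M} (hr : r ∈ P.results ρ) (hr₀ : r.1 ≠ 0)
    {τ : Matrix (Fin M × Fin M) (Fin M × Fin M) ℂ} (hτ : r.2 = some τ) : IsState τ := by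
  rw [← Multiset.mem_coe, results_eq hΩ, Multiset.mem_bind] at hr
  obtain ⟨s, -, hs⟩ := hr
  rw [Multiset.insert_eq_cons, Multiset.mem_cons, Multiset.mem_singleton] at hs
  obtain rfl | rfl := hs
  · cases hτ
  · obtain rfl := Option.some.inj hτ
    refine ⟨(posSemidef_output _).smul (inv_nonneg.mpr (weight_nonneg _)), ?_⟩
    rw [Matrix.trace_smul, trace_output (hread s), Complex.real_smul, ← Complex.ofReal_mul,
      inv_mul_cancel₀ hr₀, Complex.ofReal_one]

lemma mul_prob_sub_prob_le (hΩ : P.HasBranches ρ Ω) (hread : ∀ s, P.Readable (Ω s)) (δ : ℝ) :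
    δ * (P.prob ρ (fun r => r ≠ none) -
        P.prob ρ (fun r => ∃ τ, r = some τ ∧ 1 - δ ≤ fidelity τ)) ≤
      ∑ s, (weight (P.branch false (Ω s)) - fidelity (P.output (Ω s))) := by
  rw [prob_ne_none hΩ, prob_fidelity_ge hΩ]
  exact mul_sum_sub_sum_filter_le _ δ (fun s => weight_nonneg _) fun s =>
    fidelity_output_le (hread s)

end Probability

end Protocol

namespace Protocol

section Success

variable {N K M : ℕ} {P : Protocol N K M} {ρ : Matrix (Fin N × Fin N) (Fin N × Fin N) ℂ}

lemma load_injective2 : Function.Injective2 P.load := fun x x' y y' h => by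
  have hbits := Function.extend_injective P.wires.injective _ h
  exact ⟨bits_clog_injective N (funext fun i => congrFun hbits (.inl i)),
    bits_clog_injective K (funext fun i => congrFun hbits (.inr i))⟩

lemma loadOp_conjTranspose_mul_self : P.loadOpᴴ * P.loadOp = 1 := by
  ext ⟨⟨x₁, x₂⟩, y₁, y₂⟩ ⟨⟨x₁', x₂'⟩, y₁', y₂'⟩
  simp only [Matrix.mul_apply, Matrix.conjTranspose_apply, loadOp, Matrix.one_apply]
  simp [load_injective2.eq_iff, eq_comm, and_assoc, and_left_comm]

lemma maxEnt_dotProduct_star (hK : K ≠ 0) : maxEnt K ⬝ᵥ star (maxEnt K) = 1 := by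
  have hsq : (√K : ℂ) * √K = K := by
    rw [← Complex.ofReal_mul, Real.mul_self_sqrt (Nat.cast_nonneg K), Complex.ofReal_natCast]
  simp [dotProduct, Fintype.sum_prod_type, maxEnt, apply_ite, hK, ← mul_inv, hsq]

lemma trace_initial (hK : K ≠ 0) : (P.initial ρ).trace = ρ.trace := by
  rw [initial, Matrix.trace_mul_comm, ← Matrix.mul_assoc, loadOp_conjTranspose_mul_self,
    Matrix.one_mul, Matrix.trace_kronecker, Matrix.trace_vecMulVec,
    maxEnt_dotProduct_star hK, mul_one]

variable {X S : Type*} [Fintype X] [Fintype S]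
  {Ω : S → Matrix (Qubits P.width × Qubits P.width) X ℂ}

lemma prob_ne_none_le_of_sum_le_zero (hΩ : P.HasBranches ρ Ω) (hread : ∀ s, P.Readable (Ω s))
    (h : ∑ s, (weight (P.branch false (Ω s)) - fidelity (P.output (Ω s))) ≤ 0) :
    P.prob ρ (fun r => r ≠ none) ≤ P.prob ρ (fun r => ∃ τ, r = some τ ∧ 1 ≤ fidelity τ) := by
  have hnonneg (s : S) : 0 ≤ weight (P.branch false (Ω s)) - fidelity (P.output (Ω s)) :=
    sub_nonneg.mpr (fidelity_output_le (hread s))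
  have hzero := (Finset.sum_eq_zero_iff_of_nonneg fun s _ => hnonneg s).mp
    (h.antisymm (Finset.sum_nonneg fun s _ => hnonneg s))
  rw [prob_ne_none hΩ, prob_fidelity_ge hΩ, Finset.sum_filter]
  refine Finset.sum_le_sum fun s hmem => ?_
  rw [← sub_eq_zero.mp (hzero s hmem)]
  split_ifs with hs
  · rfl
  · by_contra hlt
    exact hs (inv_mul_cancel₀ (not_le.mp hlt).ne').ge

lemma one_sub_mul_prob_ne_none_le {δ q : ℝ} (hΩ : P.HasBranches ρ Ω)
    (hread : ∀ s, P.Readable (Ω s)) (hδ : 0 ≤ δ) (hq : 0 ≤ q)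
    (h : ∑ s, (weight (P.branch false (Ω s)) - fidelity (P.output (Ω s))) ≤
      δ * (q * P.prob ρ (fun r => r ≠ none))) :
    (1 - q) * P.prob ρ (fun r => r ≠ none) ≤
      P.prob ρ (fun r => ∃ τ, r = some τ ∧ 1 - δ ≤ fidelity τ) := by
  obtain rfl | hδ := hδ.eq_or_lt
  · have hW : 0 ≤ P.prob ρ (fun r => r ≠ none) := by
      rw [prob_ne_none hΩ]
      exact Finset.sum_nonneg fun s _ => weight_nonneg _
    rw [zero_mul] at h
    rw [sub_zero]
    nlinarith [prob_ne_none_le_of_sum_le_zero hΩ hread h]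
  · linarith [le_of_mul_le_mul_left ((mul_prob_sub_prob_le hΩ hread δ).trans h) hδ]

end Success

end Protocol

/-! ### Random Pauli checks -/

section Checks

variable {ι X : Type*} [Fintype ι]

lemma sgn_one : sgn 1 = -1 := rfl

lemma norm_sgn (b : Bool) : ‖sgn b‖ = 1 := by cases b <;> simp [sgn]

lemma sum_sgn_dotProduct [DecidableEq ι] (d : ι → Bool) :
    ∑ v : ι → Bool, sgn (v ⬝ᵥ d) = if d = 0 then (Fintype.card (ι → Bool) : ℂ) else 0 := by
  split_ifs with hd
  · simp [hd, sgn_zero]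
  · obtain ⟨j, hj⟩ := Function.ne_iff.mp hd
    have hflip (v : ι → Bool) : sgn ((v + Pi.single j 1) ⬝ᵥ d) = -sgn (v ⬝ᵥ d) := by
      have hdj : d j = 1 := by simpa [Bool.one_eq_true, Bool.zero_eq_false] using hj
      rw [add_dotProduct, single_dotProduct, hdj, one_mul, sgn_add, sgn_one,
        mul_neg_one]
    have hneg := Equiv.sum_comp (Equiv.addRight (Pi.single j 1)) fun v : ι → Bool => sgn (v ⬝ᵥ d)
    simp only [Equiv.coe_addRight, hflip, Finset.sum_neg_distrib] at hneg
    exact self_eq_neg.mp hneg.symm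

/-- Both parties apply the Pauli operator `X^u Z^v` to their strings; it fixes the maximally
entangled vector. -/
def pauli (u v : ι → Bool) (χ : Matrix ((ι → Bool) × (ι → Bool)) X ℂ) :
    Matrix ((ι → Bool) × (ι → Bool)) X ℂ :=
  Matrix.of fun p x => sgn (v ⬝ᵥ (p.1 + p.2)) * χ (p + (u, u)) x

/-- The projection to the `+1` eigenspace of the Pauli operator with the masks `r`. -/
noncomputable def check (r : ι ⊕ ι → Bool) (χ : Matrix ((ι → Bool) × (ι → Bool)) X ℂ) :
    Matrix ((ι → Bool) × (ι → Bool)) X ℂ :=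
  (1 / 2 : ℝ) • (χ + pauli (r ∘ .inl) (r ∘ .inr) χ)

/-- The successive projections with the masks `R 0, …, R (T - 1)`. -/
noncomputable def checks {T : ℕ} (R : Fin T → ι ⊕ ι → Bool)
    (χ : Matrix ((ι → Bool) × (ι → Bool)) X ℂ) : Matrix ((ι → Bool) × (ι → Bool)) X ℂ :=
  (List.finRange T).foldl (fun χ k => check (R k) χ) χ

lemma checks_cons {T : ℕ} (r : ι ⊕ ι → Bool) (R : Fin T → ι ⊕ ι → Bool)
    (χ : Matrix ((ι → Bool) × (ι → Bool)) X ℂ) :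
    checks (Fin.cons r R) χ = checks R (check r χ) := by
  simp only [checks, List.finRange_succ, List.foldl_cons, List.foldl_map, Fin.cons_zero,
    Fin.cons_succ]

variable [DecidableEq ι] [Fintype X]

lemma weight_pauli (u v : ι → Bool) (χ : Matrix ((ι → Bool) × (ι → Bool)) X ℂ) :
    weight (pauli u v χ) = weight χ := by
  simp only [weight, pauli, Matrix.of_apply, norm_mul, norm_sgn, one_mul]
  exact Equiv.sum_comp (Equiv.addRight (u, u)) fun p => ∑ x, ‖χ p x‖ ^ 2

lemma overlap_check (r : ι ⊕ ι → Bool) (χ : Matrix ((ι → Bool) × (ι → Bool)) X ℂ) :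
    overlap (check r χ) = overlap χ := by
  have hsum (x : X) : ∑ p, check r χ (p, p) x = ∑ p, χ (p, p) x := by
    have hshift := Equiv.sum_comp (Equiv.addRight (r ∘ .inl)) fun p => χ (p, p) x
    simp only [Equiv.coe_addRight] at hshift
    simp only [check, pauli, Matrix.smul_apply, Matrix.add_apply, Matrix.of_apply,
      boolVec_add_self, dotProduct_zero, sgn_zero, one_mul, Prod.mk_add_mk, ← Finset.smul_sum,
      Finset.sum_add_distrib, hshift]
    rw [smul_add, ← add_smul, add_halves, one_smul]
  simp only [overlap, hsum]

lemma sum_inner_pauli (χ : Matrix ((ι → Bool) × (ι → Bool)) X ℂ) :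
    ∑ u, ∑ v, ∑ p, ∑ x, inner ℝ (χ p x) (pauli u v χ p x) =
      (Fintype.card (ι → Bool) : ℝ) ^ 2 * overlap χ := by
  have hsigns (u : ι → Bool) (p : (ι → Bool) × (ι → Bool)) (x : X) :
      ∑ v, inner ℝ (χ p x) (pauli u v χ p x) = if p.2 = p.1 then
        Fintype.card (ι → Bool) * inner ℝ (χ p x) (χ (p + (u, u)) x) else 0 := by
    have hzero : p.1 + p.2 = 0 ↔ p.2 = p.1 := by
      simp only [funext_iff, Pi.add_apply, Pi.zero_apply, BooleanRing.add_eq_zero']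
      exact forall_congr' fun _ => eq_comm
    simp only [pauli, Matrix.of_apply, ← inner_sum, ← Finset.sum_mul, sum_sgn_dotProduct, hzero]
    split_ifs
    · rw [← Complex.ofReal_natCast, ← Complex.real_smul, real_inner_smul_right]
    · simp only [zero_mul, inner_zero_right]
  have hshift (p : ι → Bool) (x : X) : ∑ u, χ (p + u, p + u) x = ∑ q, χ (q, q) x :=
    Equiv.sum_comp (Equiv.addLeft p) fun q => χ (q, q) x
  calc ∑ u, ∑ v, ∑ p, ∑ x, inner ℝ (χ p x) (pauli u v χ p x)
      = ∑ u, ∑ p, ∑ x, ∑ v, inner ℝ (χ p x) (pauli u v χ p x) := by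
        refine Finset.sum_congr rfl fun u _ => ?_
        rw [Finset.sum_comm]
        exact Finset.sum_congr rfl fun p _ => Finset.sum_comm
    _ = ∑ u : ι → Bool, ∑ p : ι → Bool, ∑ x,
          Fintype.card (ι → Bool) * inner ℝ (χ (p, p) x) (χ (p + u, p + u) x) := by
        simp only [hsigns, Fintype.sum_prod_type, Finset.sum_ite_irrel, Finset.sum_const_zero,
          Finset.sum_ite_eq', Finset.mem_univ, if_true, Prod.mk_add_mk]
    _ = Fintype.card (ι → Bool) * ∑ x, inner ℝ (∑ p, χ (p, p) x) (∑ p, χ (p, p) x) := by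
        simp only [← Finset.mul_sum]
        congr 1
        rw [Finset.sum_comm, Finset.sum_congr rfl fun p _ => Finset.sum_comm, Finset.sum_comm]
        simp only [← inner_sum, hshift, ← sum_inner]
    _ = (Fintype.card (ι → Bool) : ℝ) ^ 2 * overlap χ := by
        simp only [real_inner_self_eq_norm_sq, overlap]
        field_simp

lemma sum_weight_check (χ : Matrix ((ι → Bool) × (ι → Bool)) X ℂ) :
    ∑ r, weight (check r χ) =
      (Fintype.card (ι → Bool) : ℝ) ^ 2 / 2 * (weight χ + overlap χ) := by
  have hcheck (r : ι ⊕ ι → Bool) : weight (check r χ) = 1 / 2 * weight χ +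
      1 / 2 * ∑ p, ∑ x, inner ℝ (χ p x) (pauli (r ∘ .inl) (r ∘ .inr) χ p x) := by
    have hpauli := weight_pauli (r ∘ .inl) (r ∘ .inr) χ
    simp only [weight, check, Matrix.smul_apply, Matrix.add_apply, norm_smul, mul_pow,
      norm_add_sq_real, Finset.sum_add_distrib, ← Finset.mul_sum] at hpauli ⊢
    rw [hpauli]
    norm_num
    ring
  have hmasks : ∑ r : ι ⊕ ι → Bool,
      ∑ p, ∑ x, inner ℝ (χ p x) (pauli (r ∘ .inl) (r ∘ .inr) χ p x) =
        (Fintype.card (ι → Bool) : ℝ) ^ 2 * overlap χ := by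
    rw [← sum_inner_pauli,
      ← Fintype.sum_prod_type' fun u v => ∑ p, ∑ x, inner ℝ (χ p x) (pauli u v χ p x)]
    exact Fintype.sum_equiv (Equiv.sumArrowEquivProdArrow ι ι Bool) _ _ fun _ => rfl
  simp only [hcheck, Finset.sum_add_distrib, Finset.sum_const, ← Finset.mul_sum, hmasks,
    Finset.card_univ, nsmul_eq_mul]
  rw [Fintype.card_congr (Equiv.sumArrowEquivProdArrow ι ι Bool), Fintype.card_prod]
  push_cast
  ring

lemma overlap_checks {T : ℕ} (R : Fin T → ι ⊕ ι → Bool)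
    (χ : Matrix ((ι → Bool) × (ι → Bool)) X ℂ) : overlap (checks R χ) = overlap χ :=
  List.foldlRecOn (motive := fun χ' => overlap χ' = overlap χ) (List.finRange T) _ rfl
    fun χ' h k _ => (overlap_check (R k) χ').trans h

lemma sum_weight_checks_sub_overlap (T : ℕ) (χ : Matrix ((ι → Bool) × (ι → Bool)) X ℂ) :
    ∑ R : Fin T → ι ⊕ ι → Bool, (weight (checks R χ) - overlap χ) =
      ((Fintype.card (ι → Bool) : ℝ) ^ 2 / 2) ^ T * (weight χ - overlap χ) := by
  induction T generalizing χ with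
  | zero => simp [checks]
  | succ T ih =>
    have hstep : ∑ r, (weight (check r χ) - overlap (check r χ)) =
        (Fintype.card (ι → Bool) : ℝ) ^ 2 / 2 * (weight χ - overlap χ) := by
      simp only [overlap_check, Finset.sum_sub_distrib, sum_weight_check, Finset.sum_const,
        Finset.card_univ, nsmul_eq_mul]
      rw [Fintype.card_congr (Equiv.sumArrowEquivProdArrow ι ι Bool), Fintype.card_prod]
      push_cast
      ring
    calc ∑ R : Fin (T + 1) → ι ⊕ ι → Bool, (weight (checks R χ) - overlap χ)
        = ∑ r, ∑ R : Fin T → ι ⊕ ι → Bool,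
            (weight (checks R (check r χ)) - overlap (check r χ)) := by
          rw [← Equiv.sum_comp (Fin.consEquiv fun _ => ι ⊕ ι → Bool), Fintype.sum_prod_type]
          exact Finset.sum_congr rfl fun r _ => Finset.sum_congr rfl fun R _ => by
            rw [overlap_check, ← checks_cons]; rfl
      _ = ((Fintype.card (ι → Bool) : ℝ) ^ 2 / 2) ^ (T + 1) * (weight χ - overlap χ) := by
          simp only [ih, ← Finset.mul_sum, hstep]
          ring

end Checks

section Numbering

lemma clog_two_pow_mul (k : ℕ) {L : ℕ} (hL : 0 < L) :
    Nat.clog 2 (2 ^ k * L) = k + Nat.clog 2 L := by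
  refine eq_of_forall_ge_iff fun c => ?_
  rw [Nat.clog_le_iff_le_pow one_lt_two]
  obtain hkc | hck := le_or_gt k c
  · obtain ⟨d, rfl⟩ := Nat.exists_eq_add_of_le hkc
    rw [pow_add, mul_le_mul_iff_right₀ (by positivity), add_le_add_iff_left,
      Nat.clog_le_iff_le_pow one_lt_two]
  · have hpow : 2 ^ c < 2 ^ k * L :=
      (Nat.pow_lt_pow_right one_lt_two hck).trans_le (Nat.le_mul_of_pos_right _ hL)
    exact iff_of_false hpow.not_ge (by lia)

/-- The binary digits of the numbers below `2 ^ k`. -/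
noncomputable def bitsEquiv (k : ℕ) : Fin (2 ^ k) ≃ (Fin k → Bool) :=
  Equiv.ofBijective (fun x => bits k x)
    ((Fintype.bijective_iff_injective_and_card _).mpr ⟨bits_injective le_rfl, by simp⟩)

/-- The positions of the binary digits of a number below `2 ^ k * L`: first the `k` lowest digits
and then those of a number below `L`. -/
def digitEquiv (k : ℕ) {L : ℕ} (hL : 0 < L) :
    Fin (Nat.clog 2 (2 ^ k * L)) ≃ Fin k ⊕ Fin (Nat.clog 2 L) :=
  (finCongr (clog_two_pow_mul k hL)).trans finSumFinEquiv.symm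

/-- The number below `2 ^ k * L` with the lowest digits `c` and the highest digits those of `l`. -/
noncomputable def joinEquiv (k L : ℕ) : (Fin k → Bool) × Fin L ≃ Fin (2 ^ k * L) :=
  ((Equiv.prodComm _ _).trans (Equiv.prodCongr (Equiv.refl _) (bitsEquiv k).symm)).trans
    (finProdFinEquiv.trans (finCongr (mul_comm L (2 ^ k))))

lemma bits_joinEquiv {k L : ℕ} (hL : 0 < L) (c : Fin k → Bool) (l : Fin L) :
    bits (Nat.clog 2 (2 ^ k * L)) (joinEquiv k L (c, l)) =
      Sum.elim c (bits (Nat.clog 2 L) l) ∘ digitEquiv k hL := by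
  obtain ⟨x, rfl⟩ := (bitsEquiv k).surjective c
  have hval : (joinEquiv k L (bitsEquiv k x, l) : ℕ) = 2 ^ k * l + x := by
    simp [joinEquiv, add_comm]
  ext i
  obtain ⟨i, rfl⟩ := (digitEquiv k hL).symm.surjective i
  rw [Function.comp_apply, Equiv.apply_symm_apply, bits, hval, Nat.testBit_two_pow_mul_add _ x.2]
  obtain i | i := i <;> simp [digitEquiv, bitsEquiv, bits]

end Numbering

/-! ### The check circuit -/

/-- The qubits of one party: its part of the input, its parts of the auxiliary state (`T` bits for
the syndromes and the remaining ones), the random masks of the `T` checks and the flags that record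
whether one of the first `k` checks failed. -/
inductive Wire (ι : Type*) (T s : ℕ) : Type _
  | input (j : ι)
  | pair (k : Fin T)
  | spare (i : Fin s)
  | mask (k : Fin T) (j : ι ⊕ ι)
  | flag (k : Fin (T + 1))

section CheckCircuit

variable {ι : Type*} {T s w : ℕ} (e : Wire ι T s ≃ Fin w)

/-- The value of one party's part of the input. -/
def inputs (a : Qubits w) : ι → Bool := fun j => a (e (.input j))

variable [Fintype ι]

/-- Check number `k`: controlled on its qubit `pair k`, each party applies to its input the Pauli
operator given by the masks. -/
noncomputable def checkGates (k : Fin T) : List (Gate w) :=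
  (Finset.univ.toList.flatMap fun j => [.toffoli (e (.mask k (.inl j))) (e (.pair k))
      (e (.input j)) (by simp) (by simp) (by simp)]) ++
    .had (e (.pair k)) :: Finset.univ.toList.flatMap fun j => [.toffoli (e (.mask k (.inr j)))
      (e (.input j)) (e (.pair k)) (by simp) (by simp) (by simp)]

/-- The label `a` after qubit `pair k` was set to `c` and, if `c = 1`, the bit mask number `k` was
added to the input. -/
noncomputable def setPair (k : Fin T) (a : Qubits w) (c : Bool) : Qubits w :=
  Function.update a (e (.pair k)) c +
    ∑ j, Pi.single (e (.input j)) (a (e (.mask k (.inl j))) * c : Bool)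

lemma circuit_checkGates_mulVec (k : Fin T) (g : Qubits w → ℂ) :
    circuit (checkGates e k) *ᵥ g = fun a => ((1 / √2 : ℝ) : ℂ) * ∑ c,
      sgn ((a (e (.pair k)) + (fun j => a (e (.mask k (.inr j)))) ⬝ᵥ inputs e a) * c) *
        g (setPair e k a c) := by
  have hbitFlips (g : Qubits w → ℂ) := circuit_flatMap_mulVec
    (G := fun j => [Gate.toffoli (e (.mask k (.inl j))) (e (.pair k)) (e (.input j))
      (by simp) (by simp) (by simp)])
    (fun j g => by rw [circuit, circuit, Matrix.one_mul, Gate.toffoli_mulVec])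
    (List.pairwise_of_forall fun _ _ _ _ => by simp) g (ks := (Finset.univ : Finset ι).toList)
  have hphaseFlips (g : Qubits w → ℂ) := circuit_flatMap_mulVec
    (G := fun j => [Gate.toffoli (e (.mask k (.inr j))) (e (.input j)) (e (.pair k))
      (by simp) (by simp) (by simp)])
    (fun j g => by rw [circuit, circuit, Matrix.one_mul, Gate.toffoli_mulVec])
    (List.pairwise_of_forall fun _ _ _ _ => by simp) g (ks := (Finset.univ : Finset ι).toList)
  simp only [Finset.sum_map_toList] at hbitFlips hphaseFlips
  rw [checkGates, circuit_append, circuit, ← Matrix.mulVec_mulVec, ← Matrix.mulVec_mulVec,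
    hbitFlips, Gate.had_mulVec, hphaseFlips]
  ext a
  have hphase : ∑ j, (Pi.single (e (.pair k))
      (a (e (.mask k (.inr j))) * a (e (.input j)) : Bool) : Qubits w) =
      Pi.single (e (.pair k)) ((fun j => a (e (.mask k (.inr j)))) ⬝ᵥ inputs e a) :=
    (map_sum (AddMonoidHom.single (fun _ => Bool) (e (.pair k))) _ _).symm
  rw [hphase, ← update_add_single]
  simp [setPair]

end CheckCircuit

section SharedForm

variable {ι X : Type*} {T s w : ℕ} (e : Wire ι T s ≃ Fin w) (L : ℕ)

/-- On the spare auxiliary wires both parties hold the same number below `L`, the masks have the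
value `R`, and no flag is set. -/
def IsStatic (R : Fin T → ι ⊕ ι → Bool) (a b : Qubits w) : Prop :=
  (∃ l : Fin L, ∀ i, a (e (.spare i)) = bits s l i ∧ b (e (.spare i)) = bits s l i) ∧
    (∀ k j, a (e (.mask k j)) = R k j ∧ b (e (.mask k j)) = R k j) ∧
    ∀ k, a (e (.flag k)) = 0 ∧ b (e (.flag k)) = 0

open Classical in
/-- The vectors `χ` of the input, together with a maximally entangled state on the wires `pair` and
`spare`. The components in which the parties differ on a wire `pair k` with `k ∈ ks` are
arbitrary, as the protocol will fail there. -/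
def IsShared (ks : List (Fin T)) (R : Fin T → ι ⊕ ι → Bool)
    (χ : Matrix ((ι → Bool) × (ι → Bool)) X ℂ) (ψ : Matrix (Qubits w × Qubits w) X ℂ) : Prop :=
  ∀ a b x, (IsStatic e L R a b → ∀ k ∈ ks, a (e (.pair k)) = b (e (.pair k))) →
    ψ (a, b) x = if IsStatic e L R a b ∧ ∀ k, a (e (.pair k)) = b (e (.pair k)) then
      χ (inputs e a, inputs e b) x else 0

variable {e L}

lemma IsShared.smul_submatrix_mark [DecidableEq ι] {ks : List (Fin T)}
    {χ : Matrix ((ι → Bool) × (ι → Bool)) X ℂ} {ψ : Matrix (Qubits w × Qubits w) X ℂ}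
    (hψ : IsShared e L ks 0 χ ψ) (S : Finset (Fin T × (ι ⊕ ι))) (c : ℂ) :
    IsShared e L ks (fun k j => decide ((k, j) ∈ S)) (c • χ) (c • ψ.submatrix
      (· + (mark (fun k => e (.mask k.1 k.2)) S, mark (fun k => e (.mask k.1 k.2)) S)) id) := by
  classical
  set m := mark (fun k : Fin T × (ι ⊕ ι) => e (.mask k.1 k.2)) S
  have hmask (k j) : m (e (.mask k j)) = decide ((k, j) ∈ S) :=
    mark_apply (f := fun k : Fin T × (ι ⊕ ι) => e (.mask k.1 k.2))
      (fun k k' h => by simpa [Prod.ext_iff] using h) S (k, j)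
  have hoff {i : Wire ι T s} (hi : ∀ k j, i ≠ .mask k j) : m (e i) = 0 :=
    mark_apply_of_notMem_range (by simpa [eq_comm] using hi) S
  have hstatic (a b) : IsStatic e L 0 (a + m) (b + m) ↔
      IsStatic e L (fun k j => decide ((k, j) ∈ S)) a b := by
    simp [IsStatic, hoff, hmask, BooleanRing.add_eq_zero']
  have hinputs (a) : inputs e (a + m) = inputs e a := by
    ext j
    simp [inputs, hoff]
  intro a b x hab
  have := hψ (a + m) (b + m) x (by simpa [hstatic, hoff] using hab)
  simpa [hstatic, hinputs, hoff] using congrArg (c * ·) this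

variable [Fintype ι] {R : Fin T → ι ⊕ ι → Bool}

lemma setPair_pair (k k' : Fin T) (a : Qubits w) (c : Bool) :
    setPair e k a c (e (.pair k')) = if k' = k then c else a (e (.pair k')) := by
  simp [setPair, Function.update_apply]

lemma inputs_setPair (k : Fin T) (a : Qubits w) (c : Bool) :
    inputs e (setPair e k a c) =
      inputs e a + fun j => (a (e (.mask k (.inl j))) * c : Bool) := by
  classical
  ext j
  simp [inputs, setPair, Pi.single_apply]

lemma isStatic_setPair (k : Fin T) (a b : Qubits w) (c c' : Bool) :
    IsStatic e L R (setPair e k a c) (setPair e k b c') ↔ IsStatic e L R a b := by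
  simp [IsStatic, setPair]

lemma half_sum_sgn_mul (α v v' : Bool) (f : Bool → ℂ) :
    ((1 / √2 : ℝ) : ℂ) * ∑ c, sgn ((α + v) * c) * (((1 / √2 : ℝ) : ℂ) *
      ∑ c', sgn ((α + v') * c') * if c = c' then f c else 0) =
    (1 / 2 : ℝ) • (f 0 + sgn (v + v') * f 1) := by
  have hsqrt : ((1 / √2 : ℝ) : ℂ) * ((1 / √2 : ℝ) : ℂ) = ((1 / 2 : ℝ) : ℂ) := by
    rw [← Complex.ofReal_mul, div_mul_div_comm, one_mul, Real.mul_self_sqrt zero_le_two]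
  have hsgn : sgn (v + v') = sgn (α + v) * sgn (α + v') := by
    rw [← sgn_add, add_add_add_comm, BooleanRing.add_self, zero_add]
  simp only [mul_ite, mul_zero, Finset.sum_ite_eq, Finset.mem_univ, if_true, hsgn,
    Complex.real_smul, ← hsqrt, Fintype.sum_bool, ← Bool.one_eq_true, ← Bool.zero_eq_false,
    mul_one, mul_zero, sgn_zero]
  ring

lemma IsShared.checkGates_mul {ks : List (Fin T)} {χ : Matrix ((ι → Bool) × (ι → Bool)) X ℂ}
    {ψ : Matrix (Qubits w × Qubits w) X ℂ} (hψ : IsShared e L ks R χ ψ) {k : Fin T}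
    (hk : k ∉ ks) : IsShared e L (k :: ks) R (check (R k) χ)
      (localOp .alice (circuit (checkGates e k)) (circuit (checkGates e k)) * ψ) := by
  classical
  intro a b x hab
  have hψ' (c c' : Bool) : ψ (setPair e k a c, setPair e k b c') x =
      if c = c' then if IsStatic e L R a b ∧ ∀ k, a (e (.pair k)) = b (e (.pair k)) then
        χ (inputs e (setPair e k a c), inputs e (setPair e k b c)) x else 0 else 0 := by
    have hiff : (∀ k', setPair e k a c (e (.pair k')) = setPair e k b c' (e (.pair k'))) ↔
        c = c' ∧ ∀ k' ≠ k, a (e (.pair k')) = b (e (.pair k')) := by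
      simp only [setPair_pair]
      refine ⟨fun h => ⟨by simpa using h k, fun k' hk' => by simpa [hk'] using h k'⟩, ?_⟩
      rintro ⟨rfl, h⟩ k'
      split_ifs with hk'
      exacts [rfl, h k' hk']
    have hpair (hs : IsStatic e L R a b) : a (e (.pair k)) = b (e (.pair k)) :=
      hab hs k List.mem_cons_self
    rw [hψ _ _ _ fun hs k' hk' => ?_]
    · simp only [isStatic_setPair, hiff]
      grind
    · have hk' : k' ≠ k ∧ k' ∈ k :: ks := by grind
      simpa [setPair_pair, hk'.1] using hab ((isStatic_setPair ..).1 hs) k' hk'.2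
  rw [localOp_alice_mul_apply]
  simp only [circuit_checkGates_mulVec, hψ']
  split_ifs with h
  · have hmask (j) : a (e (.mask k j)) = R k j ∧ b (e (.mask k j)) = R k j := h.1.2.1 k j
    simp only [hmask, inputs_setPair, ← h.2 k, half_sum_sgn_mul]
    simp [check, pauli, dotProduct_add, Function.comp_def, ← Pi.zero_def]
  · simp

lemma IsShared.flatMap_checkGates_mul {js ks : List (Fin T)} (hjs : (js ++ ks).Nodup)
    {χ : Matrix ((ι → Bool) × (ι → Bool)) X ℂ} {ψ : Matrix (Qubits w × Qubits w) X ℂ}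
    (hψ : IsShared e L ks R χ ψ) :
    IsShared e L (js.reverse ++ ks) R (js.foldl (fun χ k => check (R k) χ) χ)
      (localOp .alice (circuit (js.flatMap (checkGates e)))
        (circuit (js.flatMap (checkGates e))) * ψ) := by
  induction js generalizing ks χ ψ with
  | nil => simpa [circuit, localOp] using hψ
  | cons j js ih =>
    have hj : j ∉ ks ∧ (js ++ j :: ks).Nodup := by
      simp only [List.cons_append, List.nodup_cons, List.nodup_middle, List.mem_append] at hjs ⊢
      exact ⟨fun h => hjs.1 (.inr h), hjs⟩
    simpa [circuit_append, ← localOp_mul, Matrix.mul_assoc] using ih hj.2 (hψ.checkGates_mul hj.1)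

end SharedForm

section Success

variable {ι X : Type*} {T s w : ℕ} (e : Wire ι T s ≃ Fin w) (L : ℕ)

/-- The party whose qubits `pair k` show which checks failed records on the flags whether one
did. -/
def flagGates : List (Gate w) :=
  (List.finRange T).flatMap fun k =>
    [.cnot (e (.flag k.castSucc)) (e (.flag k.succ)) (by simp [k.castSucc_lt_succ.ne]),
      .cnot (e (.pair k)) (e (.flag k.succ)) (by simp),
      .toffoli (e (.flag k.castSucc)) (e (.pair k)) (e (.flag k.succ)) (by simp)
        (by simp [k.castSucc_lt_succ.ne]) (by simp)]

lemma circuit_flagGates_mulVec (g : Qubits w → ℂ) : circuit (flagGates e) *ᵥ g = fun a =>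
    g (a + ∑ k : Fin T, Pi.single (e (.flag k.succ))
      (a (e (.flag k.castSucc)) || a (e (.pair k)))) := by
  have hor (y z : Bool) : (y || z) = y * z + z + y := by cases y <;> cases z <;> rfl
  rw [flagGates, circuit_flatMap_mulVec (t := fun k => e (.flag k.succ))
    (h := fun k a => a (e (.flag k.castSucc)) || a (e (.pair k)))]
  · simp [Fin.sum_univ_def]
  · intro k g
    have hne : k.castSucc ≠ k.succ := k.castSucc_lt_succ.ne
    ext a
    simp [circuit, ← Matrix.mulVec_mulVec, Gate.toffoli_mulVec, Gate.cnot_mulVec, hor, hne,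
      Pi.single_add, add_assoc]
  · refine (List.pairwise_lt_finRange T).imp fun {k k'} hk a c => ?_
    have hne : k.castSucc ≠ k'.succ := (Fin.castSucc_lt_succ_iff.mpr hk.le).ne
    simp [hne]

lemma eq_zero_of_or_eq_succ {f : Fin (T + 1) → Bool} {p : Fin T → Bool}
    (h : ∀ k, f k.succ = (f k.castSucc || p k)) (hlast : f (Fin.last T) = 0) :
    f = 0 ∧ p = 0 := by
  have hf (k) : f k = 0 := by
    induction k using Fin.reverseInduction with
    | last => exact hlast
    | cast k ih => exact (Bool.or_eq_false_iff.mp ((h k).symm.trans ih)).1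
  exact ⟨funext hf, funext fun k => (Bool.or_eq_false_iff.mp ((h k).symm.trans (hf _))).2⟩

/-- A basis label with the value `p` of the input, the syndromes `c`, the number `l` on the wires
`spare` and the masks `R`. -/
def label (p : ι → Bool) (c : Fin T → Bool) (l : ℕ) (R : Fin T → ι ⊕ ι → Bool) : Qubits w :=
  fun i => match e.symm i with
    | .input j => p j
    | .pair k => c k
    | .spare i => bits s l i
    | .mask k j => R k j
    | .flag _ => 0

variable {e L}

lemma eq_label_iff {p : ι → Bool} {c : Fin T → Bool} {l : ℕ} {R : Fin T → ι ⊕ ι → Bool}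
    {a : Qubits w} : a = label e p c l R ↔ inputs e a = p ∧ (∀ k, a (e (.pair k)) = c k) ∧
      (∀ i, a (e (.spare i)) = bits s l i) ∧ (∀ k j, a (e (.mask k j)) = R k j) ∧
      ∀ k, a (e (.flag k)) = 0 := by
  constructor
  · rintro rfl
    simp [label, inputs, funext_iff]
  · rintro ⟨rfl, hpair, hspare, hmask, hflag⟩
    funext i
    obtain ⟨j, rfl⟩ := e.surjective i
    cases j <;> simp [label, inputs, *]

variable (e) in
/-- The basis label that Alice's part of the exchange of the syndromes `Y` and `flagGates` turn
into `a`. -/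
noncomputable def preFlag (Y : Finset (Fin T)) (a : Qubits w) : Qubits w :=
  a + (∑ k : Fin T, Pi.single (e (.flag k.succ))
    (a (e (.flag k.castSucc)) || a (e (.pair k)))) + mark (fun k => e (.pair k)) Y

section PreFlag

variable (Y : Finset (Fin T)) (a : Qubits w)

lemma preFlag_pair (k : Fin T) :
    preFlag e Y a (e (.pair k)) = a (e (.pair k)) + decide (k ∈ Y) := by
  have hmark : mark (fun k => e (.pair k)) Y (e (.pair k)) = decide (k ∈ Y) :=
    mark_apply (f := fun k => e (.pair k)) (fun k k' h => by simpa using h) Y k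
  simp [preFlag, hmark]

lemma mark_pair_eq_zero {i : Wire ι T s} (hi : ∀ k, i ≠ .pair k) :
    mark (fun k => e (.pair k)) Y (e i) = 0 :=
  mark_apply_of_notMem_range (by simpa [eq_comm] using hi) Y

lemma preFlag_flag_zero : preFlag e Y a (e (.flag 0)) = a (e (.flag 0)) := by
  simp [preFlag, mark_pair_eq_zero, Fin.succ_ne_zero, eq_comm]

lemma preFlag_flag_succ (k : Fin T) : preFlag e Y a (e (.flag k.succ)) =
    a (e (.flag k.succ)) + (a (e (.flag k.castSucc)) || a (e (.pair k))) := by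
  simp [preFlag, mark_pair_eq_zero, Pi.single_apply]

lemma preFlag_eq_self {i : Wire ι T s} (hi : ∀ k, i ≠ .pair k) (hi' : ∀ k, i ≠ .flag k) :
    preFlag e Y a (e i) = a (e i) := by
  simp [preFlag, mark_pair_eq_zero Y hi, hi']

variable {Y a}

lemma isStatic_preFlag_iff (ha : a (e (.flag (Fin.last T))) = 0) {R : Fin T → ι ⊕ ι → Bool}
    {b : Qubits w} :
    (IsStatic e L R (preFlag e Y a) b ∧ ∀ k, b (e (.pair k)) = decide (k ∈ Y)) ↔
      ∃ l : Fin L, a = label e (inputs e a) 0 l R ∧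
        b = label e (inputs e b) (fun k => decide (k ∈ Y)) l R := by
  have hflags : (∀ k, preFlag e Y a (e (.flag k)) = 0) ↔
      (∀ k, a (e (.flag k)) = 0) ∧ ∀ k, a (e (.pair k)) = 0 := by
    simp only [Fin.forall_fin_succ (P := fun k => preFlag e Y a (e (.flag k)) = 0),
      preFlag_flag_zero, preFlag_flag_succ, BooleanRing.add_eq_zero']
    constructor
    · rintro ⟨-, h⟩
      obtain ⟨hf, hp⟩ := eq_zero_of_or_eq_succ (f := fun k => a (e (.flag k)))
        (p := fun k => a (e (.pair k))) h ha
      exact ⟨congrFun hf, congrFun hp⟩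
    · rintro ⟨hf, hp⟩
      simp [hf, hp]
  simp only [IsStatic, eq_label_iff, forall_and, hflags, preFlag_eq_self, ne_eq, reduceCtorEq,
    not_false_eq_true, implies_true, Pi.zero_apply, true_and, ← exists_and_right]
  exact exists_congr fun l => by tauto

end PreFlag

open Classical in
lemma IsShared.flagGates_mul {ks : List (Fin T)} {R : Fin T → ι ⊕ ι → Bool}
    {χ : Matrix ((ι → Bool) × (ι → Bool)) X ℂ} {ψ : Matrix (Qubits w × Qubits w) X ℂ}
    (hψ : IsShared e L ks R χ ψ) (Y : Finset (Fin T)) {a : Qubits w}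
    (ha : a (e (.flag (Fin.last T))) = 0) (b : Qubits w) (x : X) :
    (localOp .alice (circuit (flagGates e)) 1 *
      Matrix.of fun (q : Qubits w × Qubits w) x =>
        if ∀ k ∈ List.finRange T, q.2 (e (.pair k)) = decide (k ∈ Y) then
          ψ (q.1 + mark (fun k => e (.pair k)) Y, q.2) x else 0) (a, b) x =
    if ∃ l : Fin L, a = label e (inputs e a) 0 l R ∧
        b = label e (inputs e b) (fun k => decide (k ∈ Y)) l R then
      χ (inputs e a, inputs e b) x else 0 := by
  have hinputs : inputs e (preFlag e Y a) = inputs e a := by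
    ext j
    simp [inputs, preFlag_eq_self]
  have hagree (h : IsStatic e L R (preFlag e Y a) b ∧ ∀ k, b (e (.pair k)) = decide (k ∈ Y)) (k) :
      preFlag e Y a (e (.pair k)) = b (e (.pair k)) := by
    obtain ⟨l, hl, -⟩ := (isStatic_preFlag_iff ha).mp h
    rw [preFlag_pair, h.2, (eq_label_iff.mp hl).2.1, Pi.zero_apply, zero_add]
  rw [localOp_alice_mul_apply, circuit_flagGates_mulVec]
  simp only [Matrix.one_mulVec, Matrix.of_apply, List.mem_finRange, forall_const,
    ← isStatic_preFlag_iff ha]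
  rw [← preFlag]
  by_cases hY : ∀ k, b (e (.pair k)) = decide (k ∈ Y)
  · rw [if_pos hY, hψ _ _ _ fun hs k _ => hagree ⟨hs, hY⟩ k, hinputs]
    exact if_congr ⟨fun h => ⟨h.1, hY⟩, fun h => ⟨h.1, hagree h⟩⟩ rfl rfl
  · rw [if_neg hY, if_neg fun h => hY h.2]

end Success

section Program

variable {ι X : Type*} {T s w : ℕ} (e : Wire ι T s ≃ Fin w) (L : ℕ)

section Steps

variable [Fintype ι]

/-- The checks, with given masks: the parties measure the syndromes, Bob sends his ones to Alice
and she compares them with hers. -/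
noncomputable def checkSteps : List (Step w) :=
  bilateral ((List.finRange T).flatMap (checkGates e)) ++
    (exchange (fun k => e (.pair k)) (List.finRange T) ++ (flagGates e).map (.gate .alice))

/-- The program of the purification protocol: checks with random masks. -/
noncomputable def purificationSteps : List (Step w) :=
  (Finset.univ.toList.flatMap fun k : Fin T × (ι ⊕ ι) => shareBit (e (.mask k.1 k.2))) ++
    checkSteps e

end Steps

open Classical in
/-- If no failure is flagged, `Ψ` is the product of the vectors `χ` of the input with the
unnormalized maximally entangled vector on the wires `spare`; the masks are `R` and Bob's syndromes
are `Y`. -/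
def IsSuccess (R : Fin T → ι ⊕ ι → Bool) (Y : Finset (Fin T))
    (χ : Matrix ((ι → Bool) × (ι → Bool)) X ℂ) (Ψ : Matrix (Qubits w × Qubits w) X ℂ) : Prop :=
  ∀ a b x, a (e (.flag (Fin.last T))) = 0 → Ψ (a, b) x =
    if ∃ l : Fin L, a = label e (inputs e a) 0 l R ∧
        b = label e (inputs e b) (fun k => decide (k ∈ Y)) l R then
      χ (inputs e a, inputs e b) x else 0

variable {e L} [Fintype ι] [Fintype X] {χ : Matrix ((ι → Bool) × (ι → Bool)) X ℂ}
  {ψ : Matrix (Qubits w × Qubits w) X ℂ}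

lemma exists_outcomes_checkSteps {R : Fin T → ι ⊕ ι → Bool} (hψ : IsShared e L [] R χ ψ) :
    ∃ Ω : Finset (Fin T) → Matrix (Qubits w × Qubits w) X ℂ,
      outcomes (checkSteps e) ψ = ∑ Y, {Ω Y * (Ω Y)ᴴ} ∧
      ∀ Y, IsSuccess e L R Y (checks R χ) (Ω Y) := by
  have hchecks := IsShared.flatMap_checkGates_mul (js := List.finRange T)
    (by simpa using List.nodup_finRange T) hψ
  refine ⟨fun Y => _, ?_, fun Y a b x ha => hchecks.flagGates_mul Y ha b x⟩
  rw [checkSteps, outcomes_bilateral_append, outcomes_exchange_append _ (List.nodup_finRange T),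
    List.toFinset_finRange, Finset.powerset_univ]
  refine Finset.sum_congr rfl fun Y _ => ?_
  rw [← List.append_nil (List.map _ _), outcomes_gates_append, outcomes_nil]
  congr!

lemma exists_outcomes_purificationSteps [DecidableEq ι] (hψ : IsShared e L [] 0 χ ψ) :
    ∃ Ω : Finset (Fin T × (ι ⊕ ι)) × Finset (Fin T) → Matrix (Qubits w × Qubits w) X ℂ,
      outcomes (purificationSteps e) ψ = ∑ s, {Ω s * (Ω s)ᴴ} ∧
      ∀ S Y, IsSuccess e L (fun k j => decide ((k, j) ∈ S)) Y
        (checks (fun k j => decide ((k, j) ∈ S))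
          (((1 / √2 : ℝ) : ℂ) ^ Fintype.card (Fin T × (ι ⊕ ι)) • χ)) (Ω (S, Y)) := by
  choose Ω hΩ hsuccess using fun S => exists_outcomes_checkSteps
    (hψ.smul_submatrix_mark S (((1 / √2 : ℝ) : ℂ) ^ Fintype.card (Fin T × (ι ⊕ ι))))
  have hinj : Function.Injective fun k : Fin T × (ι ⊕ ι) => e (.mask k.1 k.2) := fun k k' h => by
    simpa [Prod.ext_iff] using h
  have hmasks : ∀ k ∈ (Finset.univ : Finset (Fin T × (ι ⊕ ι))).toList, ∀ a b x,
      a (e (.mask k.1 k.2)) ≠ 0 → ψ (a, b) x = 0 := fun k _ a b x hk => by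
    rw [hψ a b x (by simp), if_neg fun h => hk (h.1.2.1 k.1 k.2).1]
  refine ⟨fun s => Ω s.1 s.2, ?_, hsuccess⟩
  rw [purificationSteps, outcomes_shareBits_append hinj (Finset.nodup_toList _) hmasks]
  simp only [Finset.length_toList, Finset.toList_toFinset, Finset.powerset_univ, Finset.card_univ,
    hΩ, Fintype.sum_prod_type]

end Program

/-! ### The purification protocol -/

/-- The five kinds of wires as a disjoint union. -/
def Wire.equivSum (ι : Type*) (T s : ℕ) :
    Wire ι T s ≃ (ι ⊕ Fin T ⊕ Fin s) ⊕ (Fin T × (ι ⊕ ι)) ⊕ Fin (T + 1) where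
  toFun
    | .input j => .inl (.inl j)
    | .pair k => .inl (.inr (.inl k))
    | .spare i => .inl (.inr (.inr i))
    | .mask k j => .inr (.inl (k, j))
    | .flag k => .inr (.inr k)
  invFun
    | .inl (.inl j) => .input j
    | .inl (.inr (.inl k)) => .pair k
    | .inl (.inr (.inr i)) => .spare i
    | .inr (.inl (k, j)) => .mask k j
    | .inr (.inr k) => .flag k
  left_inv i := by cases i <;> rfl
  right_inv i := by rcases i with ((j | k | i) | k | k) <;> rfl

instance {ι : Type*} [Fintype ι] {T s : ℕ} : Fintype (Wire ι T s) :=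
  .ofEquiv _ (Wire.equivSum ι T s).symm

/-- The binary digits of the numbers below `2 ^ (u + v)`: the `u` lowest and the `v` highest. -/
def splitEquiv (u v : ℕ) : Fin (Nat.clog 2 (2 ^ (u + v))) ≃ Fin u ⊕ Fin v :=
  (finCongr (Nat.clog_pow 2 (u + v) one_lt_two)).trans finSumFinEquiv.symm

/-- The number below `2 ^ (u + v)` with given binary digits. -/
noncomputable def wordEquiv (u v : ℕ) : (Fin u ⊕ Fin v → Bool) ≃ Fin (2 ^ (u + v)) :=
  (Equiv.arrowCongr finSumFinEquiv (Equiv.refl Bool)).trans (bitsEquiv (u + v)).symm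

lemma bits_wordEquiv {u v : ℕ} (p : Fin u ⊕ Fin v → Bool) :
    bits (Nat.clog 2 (2 ^ (u + v))) (wordEquiv u v p) = p ∘ splitEquiv u v := by
  have hbits : bits (u + v) (wordEquiv u v p) = p ∘ finSumFinEquiv.symm :=
    (bitsEquiv (u + v)).apply_symm_apply _
  ext i
  exact congrFun hbits (finCongr (Nat.clog_pow 2 (u + v) one_lt_two) i)

/-- The purification protocol with `T` checks: the output consists of the `u` lowest qubits of the
input and the unused part of the auxiliary state. -/
noncomputable def purification (u v T : ℕ) {L : ℕ} (hL : 0 < L) :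
    Protocol (2 ^ (u + v)) (2 ^ T * L) (2 ^ u * L) where
  width := Fintype.card (Wire (Fin u ⊕ Fin v) T (Nat.clog 2 L))
  wires := ((splitEquiv u v).sumCongr (digitEquiv T hL)).toEmbedding.trans <|
    Function.Embedding.inl.trans <|
      ((Wire.equivSum _ _ _).symm.trans (Fintype.equivFin _)).toEmbedding
  outWire := (digitEquiv u hL).toEmbedding.trans <|
    (Function.Embedding.inl.sumMap Function.Embedding.inr).trans <| Function.Embedding.inl.trans <|
      ((Wire.equivSum _ _ _).symm.trans (Fintype.equivFin _)).toEmbedding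
  failWire := Fintype.equivFin _ (.flag (Fin.last T))
  program := purificationSteps (Fintype.equivFin _)

section Purification

variable {u v T L : ℕ} {hL : 0 < L}

variable (u v T hL) in
/-- The wires of the purification protocol. -/
noncomputable def wire :
    Wire (Fin u ⊕ Fin v) T (Nat.clog 2 L) ≃ Fin (purification u v T hL).width :=
  Fintype.equivFin _

lemma wires_apply (i : Fin (Nat.clog 2 (2 ^ (u + v))) ⊕ Fin (Nat.clog 2 (2 ^ T * L))) :
    (purification u v T hL).wires i = wire u v T hL
      ((Wire.equivSum _ _ _).symm (.inl (Sum.map (splitEquiv u v) (digitEquiv T hL) i))) := rfl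

lemma outWire_apply (i : Fin (Nat.clog 2 (2 ^ u * L))) :
    (purification u v T hL).outWire i = wire u v T hL
      ((Wire.equivSum _ _ _).symm (.inl (Sum.map .inl .inr (digitEquiv u hL i)))) := rfl

lemma load_apply (p : Fin u ⊕ Fin v → Bool) (c : Fin T → Bool) (l : Fin L)
    (i : (Fin u ⊕ Fin v) ⊕ Fin T ⊕ Fin (Nat.clog 2 L)) :
    (purification u v T hL).load (wordEquiv u v p) (joinEquiv T L (c, l))
        (wire u v T hL ((Wire.equivSum _ _ _).symm (.inl i))) =
      Sum.elim p (Sum.elim c (bits _ l)) i := by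
  obtain ⟨i, rfl⟩ := ((splitEquiv u v).sumCongr (digitEquiv T hL)).surjective i
  refine ((purification u v T hL).wires.injective.extend_apply _ _ i).trans ?_
  cases i <;> simp [bits_wordEquiv, bits_joinEquiv hL]

lemma load_apply_eq_zero {x : Fin (2 ^ (u + v))} {y : Fin (2 ^ T * L)}
    (i : Fin T × ((Fin u ⊕ Fin v) ⊕ (Fin u ⊕ Fin v)) ⊕ Fin (T + 1)) :
    (purification u v T hL).load x y (wire u v T hL ((Wire.equivSum _ _ _).symm (.inr i))) = 0 := by
  refine Function.extend_apply' _ _ _ ?_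
  rintro ⟨j, hj⟩
  simp [wires_apply] at hj

lemma load_eq_label (p : Fin u ⊕ Fin v → Bool) (c : Fin T → Bool) (l : Fin L) :
    (purification u v T hL).load (wordEquiv u v p) (joinEquiv T L (c, l)) =
      label (wire u v T hL) p c l 0 :=
  eq_label_iff.mpr ⟨funext fun j => load_apply p c l (.inl j),
    fun k => load_apply p c l (.inr (.inl k)), fun i => load_apply p c l (.inr (.inr i)),
    fun k j => load_apply_eq_zero (.inl (k, j)), fun k => load_apply_eq_zero (.inr k)⟩

variable {R : Fin T → (Fin u ⊕ Fin v) ⊕ (Fin u ⊕ Fin v) → Bool}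

lemma reads_label (h : Fin u → Bool) (z : Fin v → Bool) (c : Fin T → Bool) (l : Fin L) :
    (purification u v T hL).Reads (label (wire u v T hL) (Sum.elim h z) c l R)
      (joinEquiv u L (h, l)) := by
  intro i
  rw [bits_joinEquiv hL, outWire_apply, Function.comp_apply]
  cases digitEquiv u hL i <;> simp [label, Wire.equivSum]

variable (hL R) in
/-- The values of the discarded wires when the discarded input qubits are `z`, the syndromes `c` and
the masks `R`. -/
noncomputable def discarded (z : Fin v → Bool) (c : Fin T → Bool) : (purification u v T hL).Rest :=
  (purification u v T hL).rest (label (wire u v T hL) (Sum.elim 0 z) c 0 R)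

lemma rest_label (h : Fin u → Bool) (z : Fin v → Bool) (c : Fin T → Bool) (l : ℕ) :
    (purification u v T hL).rest (label (wire u v T hL) (Sum.elim h z) c l R) =
      discarded hL R z c := by
  have hout (i : Fin u ⊕ Fin (Nat.clog 2 L)) : wire u v T hL
      ((Wire.equivSum _ _ _).symm (.inl (Sum.map .inl .inr i))) ∈
        Set.range (purification u v T hL).outWire :=
    ⟨(digitEquiv u hL).symm i, by rw [outWire_apply, Equiv.apply_symm_apply]⟩
  ext ⟨i, hi⟩
  obtain ⟨i, rfl⟩ := (wire u v T hL).surjective i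
  rw [discarded, Protocol.rest, Protocol.rest]
  obtain (j | j) | k | i | k | k := i
  · exact absurd (hout (.inl j)) hi
  · simp [label]
  · simp [label]
  · exact absurd (hout (.inr i)) hi
  · simp [label]
  · simp [label]

lemma assemble_discarded (h : Fin u → Bool) (z : Fin v → Bool) (c : Fin T → Bool) (l : Fin L) :
    (purification u v T hL).assemble (discarded hL R z c) (joinEquiv u L (h, l)) =
      label (wire u v T hL) (Sum.elim h z) c l R := by
  rw [← rest_label h z c l]
  exact Protocol.assemble_rest (reads_label h z c l)

lemma discarded_injective (c : Fin T → Bool) :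
    Function.Injective fun z => discarded hL R z c := fun z z' h => by
  ext j
  have hj : wire u v T hL (.input (.inr j)) ∉ Set.range (purification u v T hL).outWire := by
    rintro ⟨i, hi⟩
    rw [outWire_apply] at hi
    cases hd : digitEquiv u hL i <;> simp [hd, Wire.equivSum] at hi
  simpa [discarded, Protocol.rest, label] using congrFun h ⟨_, hj⟩

end Purification

section Output

variable {ι X : Type*} {T s w L : ℕ} {e : Wire ι T s ≃ Fin w} {R : Fin T → ι ⊕ ι → Bool}
  {Y : Finset (Fin T)} {χ : Matrix ((ι → Bool) × (ι → Bool)) X ℂ}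
  {Ψ : Matrix (Qubits w × Qubits w) X ℂ}

lemma label_flag (p : ι → Bool) (c : Fin T → Bool) (l : ℕ) (k : Fin (T + 1)) :
    label e p c l R (e (.flag k)) = 0 := by simp [label]

lemma inputs_label (p : ι → Bool) (c : Fin T → Bool) (l : ℕ) : inputs e (label e p c l R) = p := by
  ext j
  simp [inputs, label]

lemma label_injective (hs : L ≤ 2 ^ s) (c : Fin T → Bool) :
    Function.Injective fun r : (ι → Bool) × Fin L => label e r.1 c r.2 R := fun r r' h => by
  have hp := congrArg (inputs e) h
  have hl : bits s r.2 = bits s r'.2 := by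
    ext i
    simpa [label] using congrFun h (e (.spare i))
  rw [inputs_label, inputs_label] at hp
  exact Prod.ext hp (bits_injective hs hl)

lemma IsSuccess.apply_label (hΨ : IsSuccess e L R Y χ Ψ) (p q : ι → Bool) (l : Fin L) (x : X) :
    Ψ (label e p 0 l R, label e q (fun k => decide (k ∈ Y)) l R) x = χ (p, q) x := by
  rw [hΨ _ _ _ (label_flag ..), inputs_label, inputs_label, if_pos ⟨l, rfl, rfl⟩]

lemma IsSuccess.exists_eq_label (hΨ : IsSuccess e L R Y χ Ψ) {a b : Qubits w} {x : X}
    (ha : a (e (.flag (Fin.last T))) = 0) (h : Ψ (a, b) x ≠ 0) : ∃ p q, ∃ l : Fin L,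
      a = label e p 0 l R ∧ b = label e q (fun k => decide (k ∈ Y)) l R := by
  rw [hΨ a b x ha] at h
  obtain ⟨l, hl⟩ := (ite_ne_right_iff.mp h).1
  exact ⟨_, _, l, hl⟩

end Output

section SuccessBranch

variable {X : Type*} {u v T L : ℕ} {hL : 0 < L}
  {R : Fin T → (Fin u ⊕ Fin v) ⊕ (Fin u ⊕ Fin v) → Bool} {Y : Finset (Fin T)}
  {χ : Matrix ((Fin u ⊕ Fin v → Bool) × (Fin u ⊕ Fin v → Bool)) X ℂ}
  {Ψ : Matrix (Qubits (purification u v T hL).width × Qubits (purification u v T hL).width) X ℂ}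

lemma IsSuccess.branch_apply_label (hΨ : IsSuccess (wire u v T hL) L R Y χ Ψ)
    (p q : Fin u ⊕ Fin v → Bool) (l : Fin L) (x : X) :
    (purification u v T hL).branch false Ψ (label (wire u v T hL) p 0 l R,
      label (wire u v T hL) q (fun k => decide (k ∈ Y)) l R) x = χ (p, q) x := by
  rw [Protocol.branch_apply, hΨ.apply_label]
  exact if_pos (label_flag ..)

lemma IsSuccess.exists_eq_label_of_branch_ne_zero (hΨ : IsSuccess (wire u v T hL) L R Y χ Ψ)
    {q x} (h : (purification u v T hL).branch false Ψ q x ≠ 0) : ∃ p p', ∃ l : Fin L,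
      q = (label (wire u v T hL) p 0 l R,
        label (wire u v T hL) p' (fun k => decide (k ∈ Y)) l R) := by
  rw [Protocol.branch_apply, ite_ne_right_iff] at h
  obtain ⟨p, p', l, h₁, h₂⟩ := hΨ.exists_eq_label h.1 h.2
  exact ⟨p, p', l, Prod.ext h₁ h₂⟩

lemma IsSuccess.readable (hΨ : IsSuccess (wire u v T hL) L R Y χ Ψ) :
    (purification u v T hL).Readable Ψ := fun q x h => by
  obtain ⟨p, p', l, rfl⟩ := hΨ.exists_eq_label_of_branch_ne_zero h
  rw [← Sum.elim_comp_inl_inr p, ← Sum.elim_comp_inl_inr p']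
  exact ⟨(joinEquiv u L (_, l), joinEquiv u L (_, l)), reads_label _ _ _ l, reads_label _ _ _ l⟩

variable [Fintype X]

lemma IsSuccess.weight_branch (hΨ : IsSuccess (wire u v T hL) L R Y χ Ψ) :
    weight ((purification u v T hL).branch false Ψ) = L * weight χ := by
  have hinj (c : Fin T → Bool) := label_injective (e := wire u v T hL) (R := R)
    (Nat.le_pow_clog one_lt_two L) c
  have hsum := Fintype.sum_of_injective
    (fun r : ((Fin u ⊕ Fin v → Bool) × (Fin u ⊕ Fin v → Bool)) × Fin L =>
      (label (wire u v T hL) r.1.1 0 r.2 R,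
        label (wire u v T hL) r.1.2 (fun k => decide (k ∈ Y)) r.2 R))
    (fun ⟨⟨p, q⟩, l⟩ ⟨⟨p', q'⟩, l'⟩ h => ?_) (fun r => ∑ x, ‖χ r.1 x‖ ^ 2)
    (fun q => ∑ x, ‖(purification u v T hL).branch false Ψ q x‖ ^ 2) (fun q hq => ?_) fun r => ?_
  · rw [weight, ← hsum, Fintype.sum_prod_type]
    simp [weight, Finset.mul_sum]
  · obtain ⟨h₁, h₂⟩ := Prod.ext_iff.mp h
    obtain ⟨rfl, rfl⟩ := Prod.ext_iff.mp (hinj 0 (a₁ := (p, l)) (a₂ := (p', l')) h₁)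
    obtain ⟨rfl, -⟩ := Prod.ext_iff.mp (hinj _ (a₁ := (q, l)) (a₂ := (q', l)) h₂)
    rfl
  · refine Finset.sum_eq_zero fun x _ => ?_
    by_contra hne
    obtain ⟨p, p', l, rfl⟩ := hΨ.exists_eq_label_of_branch_ne_zero
      (norm_ne_zero_iff.mp (ne_zero_pow two_ne_zero hne))
    exact hq ⟨((p, p'), l), rfl⟩
  · simp only [hΨ.branch_apply_label]

lemma IsSuccess.mul_overlap_le (hΨ : IsSuccess (wire u v T hL) L R Y χ Ψ) :
    L * overlap χ ≤ fidelity ((purification u v T hL).output Ψ) := by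
  have hd : Function.Injective fun z => (discarded hL R z 0,
      discarded hL R z fun k => decide (k ∈ Y)) := fun z z' h =>
    discarded_injective 0 (Prod.ext_iff.mp h).1
  refine le_trans ?_ (Protocol.sum_overlap_le_fidelity_readOut hd _)
  have hcard : (Fintype.card (Fin u ⊕ Fin v → Bool) : ℝ) = 2 ^ u * 2 ^ v := by simp [pow_add]
  have hz (z : Fin v → Bool) (x : X) : ∑ i, (purification u v T hL).branch false Ψ
      ((purification u v T hL).outLabel (discarded hL R z 0, discarded hL R z
        fun k => decide (k ∈ Y)) (i, i)) x =
      L * ∑ h, χ (Sum.elim h z, Sum.elim h z) x := by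
    rw [← Equiv.sum_comp (joinEquiv u L), Fintype.sum_prod_type]
    simp only [Protocol.outLabel, assemble_discarded, hΨ.branch_apply_label]
    simp [Finset.mul_sum]
  have hsplit (x : X) : ∑ p, χ (p, p) x = ∑ z, ∑ h, χ (Sum.elim h z, Sum.elim h z) x := by
    rw [Finset.sum_comm, ← Equiv.sum_comp (Equiv.sumArrowEquivProdArrow _ _ _).symm,
      Fintype.sum_prod_type]
    rfl
  have hnorm (x : X) : ‖∑ z, ∑ h, χ (Sum.elim h z, Sum.elim h z) x‖ ^ 2 ≤
      2 ^ v * ∑ z : Fin v → Bool, ‖∑ h, χ (Sum.elim h z, Sum.elim h z) x‖ ^ 2 := by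
    simpa using norm_sum_sq_le Finset.univ fun z : Fin v → Bool =>
      ∑ h, χ (Sum.elim h z, Sum.elim h z) x
  calc L * overlap χ ≤
        L * ((∑ x, 2 ^ v * ∑ z : Fin v → Bool, ‖∑ h, χ (Sum.elim h z, Sum.elim h z) x‖ ^ 2) /
          (2 ^ u * 2 ^ v)) := by
        rw [overlap, hcard]
        gcongr with x
        rw [hsplit]
        exact hnorm x
    _ = L * (∑ z : Fin v → Bool, ∑ x, ‖∑ h, χ (Sum.elim h z, Sum.elim h z) x‖ ^ 2) / 2 ^ u := by
        rw [← Finset.mul_sum, Finset.sum_comm, mul_comm (2 ^ u),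
          mul_div_mul_left _ _ (by positivity), mul_div_assoc]
    _ = _ := by
        have hL₀ : (L : ℝ) ≠ 0 := Nat.cast_ne_zero.mpr hL.ne'
        simp only [overlap, Matrix.submatrix_apply, id_eq, hz, norm_mul, mul_pow, ← Finset.mul_sum,
          Complex.norm_natCast, Fintype.card_fin, ← Finset.sum_div]
        push_cast
        field_simp

end SuccessBranch

namespace Protocol

section Initial

variable {N K M : ℕ} {X : Type*} (P : Protocol N K M)

/-- The vectors of the initial joint state when the columns of `C` are those of the input state. -/
noncomputable def initialVectors (C : Matrix (Fin N × Fin N) X ℂ) :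
    Matrix (Qubits P.width × Qubits P.width) X ℂ :=
  P.loadOp *
    (Matrix.of fun r x => C r.1 x * maxEnt K r.2 : Matrix ((Fin N × Fin N) × Fin K × Fin K) X ℂ)

variable {P}

lemma initial_mul_conjTranspose [Fintype X] (C : Matrix (Fin N × Fin N) X ℂ) :
    P.initial (C * Cᴴ) = P.initialVectors C * (P.initialVectors C)ᴴ := by
  simp only [initial, initialVectors, Matrix.conjTranspose_mul, Matrix.mul_assoc]
  congr 1
  rw [← Matrix.mul_assoc]
  congr 1
  ext r r'
  simp [Matrix.mul_apply, Matrix.vecMulVec_apply, Finset.sum_mul, mul_mul_mul_comm]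

lemma initialVectors_load (C : Matrix (Fin N × Fin N) X ℂ) (x x' : Fin N) (y y' : Fin K) (i : X) :
    P.initialVectors C (P.load x y, P.load x' y') i = C (x, x') i * maxEnt K (y, y') := by
  simp [initialVectors, Matrix.mul_apply, loadOp, load_injective2.eq_iff, Fintype.sum_prod_type,
    ite_and]

lemma exists_eq_load_of_initialVectors_ne_zero {C : Matrix (Fin N × Fin N) X ℂ}
    {q : Qubits P.width × Qubits P.width} {i : X} (h : P.initialVectors C q i ≠ 0) :
    ∃ x x' y y', q = (P.load x y, P.load x' y') := by
  rw [initialVectors, Matrix.mul_apply] at h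
  obtain ⟨r, -, hr⟩ := Finset.exists_ne_zero_of_sum_ne_zero h
  exact ⟨_, _, _, _, (ite_ne_right_iff.mp (left_ne_zero_of_mul hr)).1⟩

end Initial

end Protocol

lemma isStatic_label_iff {ι : Type*} {T s w L : ℕ} {e : Wire ι T s ≃ Fin w}
    {R : Fin T → ι ⊕ ι → Bool} (hs : L ≤ 2 ^ s) (p p' : ι → Bool) (c c' : Fin T → Bool)
    (l l' : Fin L) : IsStatic e L R (label e p c l R) (label e p' c' l' R) ↔ l = l' := by
  constructor
  · rintro ⟨⟨i, hi⟩, -, -⟩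
    simp only [label, Equiv.symm_apply_apply] at hi
    exact bits_injective hs (funext fun k => (hi k).1.trans (hi k).2.symm)
  · rintro rfl
    simpa [IsStatic, label] using ⟨l, fun _ => rfl⟩

lemma isShared_initialVectors {u v T L : ℕ} {hL : 0 < L} {X : Type*}
    (C : Matrix (Fin (2 ^ (u + v)) × Fin (2 ^ (u + v))) X ℂ) :
    IsShared (wire u v T hL) L [] 0
      (((1 / √(2 ^ T * L : ℕ) : ℝ) : ℂ) • C.submatrix (Prod.map (wordEquiv u v) (wordEquiv u v)) id)
      ((purification u v T hL).initialVectors C) := fun a b x _ => by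
  by_cases hab : ∃ p p' c c', ∃ l l' : Fin L,
      (a, b) = (label (wire u v T hL) p c l 0, label (wire u v T hL) p' c' l' 0)
  · obtain ⟨p, p', c, c', l, l', h⟩ := hab
    obtain ⟨rfl, rfl⟩ := Prod.ext_iff.mp h
    rw [isStatic_label_iff (Nat.le_pow_clog one_lt_two L), ← load_eq_label, ← load_eq_label,
      Protocol.initialVectors_load, load_eq_label, load_eq_label, inputs_label, inputs_label]
    simp [maxEnt, label, and_comm, funext_iff, mul_comm]
  · rw [if_neg]
    · by_contra h
      obtain ⟨x, x', y, y', hq⟩ := Protocol.exists_eq_load_of_initialVectors_ne_zero h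
      obtain ⟨p, rfl⟩ := (wordEquiv u v).surjective x
      obtain ⟨p', rfl⟩ := (wordEquiv u v).surjective x'
      obtain ⟨⟨c, l⟩, rfl⟩ := (joinEquiv T L).surjective y
      obtain ⟨⟨c', l'⟩, rfl⟩ := (joinEquiv T L).surjective y'
      exact hab ⟨p, p', c, c', l, l', by rw [hq, load_eq_label, load_eq_label]⟩
    · rintro ⟨⟨⟨l, hl⟩, hmask, hflag⟩, hpair⟩
      exact hab ⟨_, _, _, _, l, l, Prod.ext
        (eq_label_iff.mpr ⟨rfl, hpair, fun i => (hl i).1, fun k j => (hmask k j).1,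
          fun k => (hflag k).1⟩)
        (eq_label_iff.mpr ⟨rfl, fun _ => rfl, fun i => (hl i).2, fun k j => (hmask k j).2,
          fun k => (hflag k).2⟩)⟩

section Encoding

lemma weight_smul {m n : Type*} [Fintype m] [Fintype n] (c : ℂ) (A : Matrix m n ℂ) :
    weight (c • A) = ‖c‖ ^ 2 * weight A := by
  simp [weight, mul_pow, Finset.mul_sum]

lemma weight_submatrix_equiv {m m' n : Type*} [Fintype m] [Fintype m'] [Fintype n] (e : m' ≃ m)
    (A : Matrix m n ℂ) : weight (A.submatrix e id) = weight A :=
  Equiv.sum_comp e fun i => ∑ j, ‖A i j‖ ^ 2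

lemma overlap_smul {B X : Type*} [Fintype B] [Fintype X] (c : ℂ) (A : Matrix (B × B) X ℂ) :
    overlap (c • A) = ‖c‖ ^ 2 * overlap A := by
  simp [overlap, ← Finset.mul_sum, mul_pow, mul_div_assoc]

lemma overlap_submatrix_equiv {B B' X : Type*} [Fintype B] [Fintype B'] [Fintype X] (e : B' ≃ B)
    (A : Matrix (B × B) X ℂ) : overlap (A.submatrix (Prod.map e e) id) = overlap A := by
  have hsum (x : X) : ∑ i, A (e i, e i) x = ∑ i, A (i, i) x :=
    Equiv.sum_comp e fun i => A (i, i) x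
  simp only [overlap, Matrix.submatrix_apply, Prod.map_apply, id_eq, Fintype.card_congr e, hsum]

variable {u v : ℕ} {X : Type*} (T L : ℕ)

/-- The vectors of an input state after the masks were drawn, indexed by the values of the input
qubits. The first factor is the amplitude of each choice of masks and the second one that of each
number shared by the parties on the auxiliary wires. -/
noncomputable def encoded (C : Matrix (Fin (2 ^ (u + v)) × Fin (2 ^ (u + v))) X ℂ) :
    Matrix ((Fin u ⊕ Fin v → Bool) × (Fin u ⊕ Fin v → Bool)) X ℂ :=
  ((1 / √2 : ℝ) : ℂ) ^ Fintype.card (Fin T × ((Fin u ⊕ Fin v) ⊕ (Fin u ⊕ Fin v))) •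
    ((1 / √(2 ^ T * L : ℕ) : ℝ) : ℂ) • C.submatrix (Prod.map (wordEquiv u v) (wordEquiv u v)) id

lemma norm_encoding_sq :
    ‖((1 / √2 : ℝ) : ℂ) ^ Fintype.card (Fin T × ((Fin u ⊕ Fin v) ⊕ (Fin u ⊕ Fin v)))‖ ^ 2 *
        ‖((1 / √(2 ^ T * L : ℕ) : ℝ) : ℂ)‖ ^ 2 =
      (2 ^ T * L * ((Fintype.card (Fin u ⊕ Fin v → Bool) : ℝ) ^ 2) ^ T)⁻¹ := by
  have hcard : Fintype.card (Fin T × ((Fin u ⊕ Fin v) ⊕ (Fin u ⊕ Fin v))) = (u + v) * 2 * T := by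
    simp only [Fintype.card_prod, Fintype.card_sum, Fintype.card_fin]
    ring
  rw [norm_pow, Complex.norm_real, Complex.norm_real, Real.norm_eq_abs, Real.norm_eq_abs,
    ← pow_mul, mul_comm _ 2, pow_mul, sq_abs, sq_abs, div_pow _ √2, div_pow _ √_,
    Real.sq_sqrt zero_le_two, Real.sq_sqrt (Nat.cast_nonneg _), hcard]
  simp only [one_pow, one_div, pow_mul, Fintype.card_fun, Fintype.card_bool, Fintype.card_sum,
    Fintype.card_fin]
  push_cast
  rw [inv_pow, inv_pow, inv_pow, ← mul_inv, mul_comm]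

variable {T L} [Fintype X]

lemma weight_encoded (C : Matrix (Fin (2 ^ (u + v)) × Fin (2 ^ (u + v))) X ℂ) :
    weight (encoded T L C) =
      (2 ^ T * L * ((Fintype.card (Fin u ⊕ Fin v → Bool) : ℝ) ^ 2) ^ T)⁻¹ * weight C := by
  rw [encoded, weight_smul, weight_smul, ← mul_assoc, norm_encoding_sq]
  exact congrArg _ (weight_submatrix_equiv ((wordEquiv u v).prodCongr (wordEquiv u v)) C)

lemma overlap_encoded (C : Matrix (Fin (2 ^ (u + v)) × Fin (2 ^ (u + v))) X ℂ) :
    overlap (encoded T L C) =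
      (2 ^ T * L * ((Fintype.card (Fin u ⊕ Fin v → Bool) : ℝ) ^ 2) ^ T)⁻¹ * overlap C := by
  rw [encoded, overlap_smul, overlap_smul, ← mul_assoc, norm_encoding_sq, overlap_submatrix_equiv]

end Encoding

lemma sum_masks_eq {ι : Type*} [Fintype ι] [DecidableEq ι] {T : ℕ}
    (f : (Fin T → ι → Bool) → ℝ) :
    ∑ s : Finset (Fin T × ι) × Finset (Fin T), f (fun k j => decide ((k, j) ∈ s.1)) =
      2 ^ T * ∑ R, f R := by
  rw [Fintype.sum_prod_type, ← Equiv.sum_comp (Equiv.curry (Fin T) ι Bool),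
    ← sum_finset_eq_sum_boolVec, Finset.mul_sum]
  refine Finset.sum_congr rfl fun S _ => ?_
  have hcard : (Fintype.card (Finset (Fin T)) : ℝ) = 2 ^ T := by simp
  rw [← hcard, ← nsmul_eq_mul]
  exact Finset.sum_const (f fun k j => decide ((k, j) ∈ S))

section Purification

variable {u v T L : ℕ} {hL : 0 < L} {X : Type*} [Fintype X]

variable (T hL) in
lemma exists_hasBranches (C : Matrix (Fin (2 ^ (u + v)) × Fin (2 ^ (u + v))) X ℂ) :
    ∃ Ω : Finset (Fin T × ((Fin u ⊕ Fin v) ⊕ (Fin u ⊕ Fin v))) × Finset (Fin T) → Matrix _ X ℂ,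
      (purification u v T hL).HasBranches (C * Cᴴ) Ω ∧
      ∀ s, IsSuccess (wire u v T hL) L (fun k j => decide ((k, j) ∈ s.1)) s.2
        (checks (fun k j => decide ((k, j) ∈ s.1)) (encoded T L C)) (Ω s) := by
  obtain ⟨Ω, hΩ, hsuccess⟩ := exists_outcomes_purificationSteps (isShared_initialVectors C)
  refine ⟨Ω, ?_, fun s => hsuccess s.1 s.2⟩
  rw [Protocol.HasBranches, Protocol.initial_mul_conjTranspose]
  rw [← Multiset.sum_map_singleton (Multiset.map _ _), Multiset.map_map]
  exact hΩ

variable (T hL) in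
lemma exists_hasBranches_of_posSemidef
    {ρ : Matrix (Fin (2 ^ (u + v)) × Fin (2 ^ (u + v))) _ ℂ} (hρ : ρ.PosSemidef) :
    ∃ (d : ℕ) (Ω : Finset (Fin T × ((Fin u ⊕ Fin v) ⊕ (Fin u ⊕ Fin v))) × Finset (Fin T) →
        Matrix _ (Fin d) ℂ),
      (purification u v T hL).HasBranches ρ Ω ∧
      (∀ s, (purification u v T hL).Readable (Ω s)) ∧
      fidelity ρ ≤ (purification u v T hL).prob ρ (fun r => r ≠ none) ∧
      ∑ s, (weight ((purification u v T hL).branch false (Ω s)) -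
        fidelity ((purification u v T hL).output (Ω s))) ≤ (ρ.trace.re - fidelity ρ) / 2 ^ T := by
  obtain ⟨d, C, rfl⟩ := exists_eq_mul_conjTranspose hρ
  obtain ⟨Ω, hΩ, hsuccess⟩ := exists_hasBranches T hL C
  have hL₀ : (L : ℝ) ≠ 0 := Nat.cast_ne_zero.mpr hL.ne'
  have hmasks : (Fintype.card (Fin T → (Fin u ⊕ Fin v) ⊕ (Fin u ⊕ Fin v) → Bool) : ℝ) =
      ((Fintype.card (Fin u ⊕ Fin v → Bool) : ℝ) ^ 2) ^ T := by
    simp [← pow_mul, mul_two]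
  rw [fidelity_mul_conjTranspose, trace_mul_conjTranspose, Complex.ofReal_re]
  refine ⟨d, Ω, hΩ, fun s => (hsuccess s).readable, ?_, ?_⟩
  · calc overlap C = ∑ _s : Finset (Fin T × ((Fin u ⊕ Fin v) ⊕ (Fin u ⊕ Fin v))) × Finset (Fin T),
          L * overlap (encoded T L C) := by
          rw [sum_masks_eq fun _ => _, Finset.sum_const, Finset.card_univ, nsmul_eq_mul, hmasks,
            overlap_encoded]
          field_simp
      _ ≤ ∑ s, weight ((purification u v T hL).branch false (Ω s)) := by
          gcongr with s
          rw [(hsuccess s).weight_branch, ← overlap_checks fun k j => decide ((k, j) ∈ s.1)]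
          gcongr
          exact overlap_le_weight _
      _ = _ := (Protocol.prob_ne_none hΩ).symm
  · calc _ ≤ ∑ s : Finset (Fin T × ((Fin u ⊕ Fin v) ⊕ (Fin u ⊕ Fin v))) × Finset (Fin T),
          L * (weight (checks (fun k j => decide ((k, j) ∈ s.1)) (encoded T L C)) -
            overlap (encoded T L C)) := by
          gcongr with s
          rw [(hsuccess s).weight_branch, mul_sub,
            ← overlap_checks (fun k j => decide ((k, j) ∈ s.1)) (encoded T L C)]
          gcongr
          exact (hsuccess s).mul_overlap_le
      _ = (weight C - overlap C) / 2 ^ T := by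
          rw [sum_masks_eq fun R => L * (weight (checks R (encoded T L C)) -
            overlap (encoded T L C)), ← Finset.mul_sum, sum_weight_checks_sub_overlap,
            weight_encoded, overlap_encoded, div_pow]
          field_simp

end Purification

section Success

variable {u v T L : ℕ} {hL : 0 < L}

lemma isGEPP_purification : (purification u v T hL).IsGEPP := fun ρ hρ r hr hr₀ τ hτ => by
  obtain ⟨_, _, hΩ, hread, -⟩ := exists_hasBranches_of_posSemidef T hL hρ.1
  exact Protocol.isState_of_mem_results hΩ hread hr hr₀ hτ

lemma prob_purification_le {ρ : Matrix (Fin (2 ^ (u + v)) × Fin (2 ^ (u + v))) _ ℂ}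
    (hρ : IsState ρ) {ε δ q : ℝ} (hρε : 1 - ε ≤ fidelity ρ) (hδ : 0 ≤ δ) (hq : 0 ≤ q)
    (hT : ε / 2 ^ T ≤ δ * (q * (1 - ε))) :
    (purification u v T hL).prob ρ (fun r => r = none) ≤ ε ∧
    (1 - q) * (purification u v T hL).prob ρ (fun r => r ≠ none) ≤
      (purification u v T hL).prob ρ (fun r => ∃ τ, r = some τ ∧ 1 - δ ≤ fidelity τ) := by
  obtain ⟨_, Ω, hΩ, hread, hsuccess, hdefect⟩ := exists_hasBranches_of_posSemidef T hL hρ.1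
  constructor
  · rw [Protocol.prob_eq_none hΩ, Protocol.trace_initial (by positivity), hρ.2, Complex.one_re]
    linarith
  · refine Protocol.one_sub_mul_prob_ne_none_le hΩ hread hδ hq (hdefect.trans ?_)
    rw [hρ.2, Complex.one_re]
    calc (1 - fidelity ρ) / 2 ^ T ≤ ε / 2 ^ T := by gcongr; linarith
      _ ≤ δ * (q * (1 - ε)) := hT
      _ ≤ _ := by gcongr; linarith

lemma Protocol.ProbSuccessful.mono_fail {N K M : ℕ} {P : Protocol N K M} {ε δ p p' q : ℝ}
    (hP : P.ProbSuccessful ε δ p q) (hp : 0 ≤ ε → p ≤ p') : P.ProbSuccessful ε δ p' q := by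
  refine ⟨hP.1, fun ρ hρ hρε => ?_⟩
  have hε : 0 ≤ ε := by linarith [fidelity_le_one hρ]
  exact ⟨(hP.2 ρ hρ hρε).1.trans (hp hε), (hP.2 ρ hρ hρε).2⟩

end Success

section Size

variable {u v T L : ℕ} {hL : 0 < L}

lemma size_purification : (purification u v T hL).size =
    12 * (T * (u + v)) + 10 * T + 2 * (u + v) + 2 * Nat.clog 2 L + 2 := by
  simp only [Protocol.size, purification, purificationSteps, checkSteps, checkGates, flagGates,
    exchange, shareBit, length_bilateral, List.length_append, List.length_flatMap,
    List.length_map, List.length_cons, List.length_nil, List.map_const', List.sum_replicate,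
    List.length_finRange, Finset.length_toList, Finset.card_univ,
    Fintype.card_congr (Wire.equivSum _ _ _), Fintype.card_sum, Fintype.card_prod,
    Fintype.card_fin, smul_eq_mul]
  ring

lemma clog_two_le_logb_add_one {n : ℕ} (hn : n ≠ 0) : (Nat.clog 2 n : ℝ) ≤ Real.logb 2 n + 1 := by
  have hlog : 0 ≤ Real.logb 2 n :=
    Real.logb_nonneg one_lt_two (Nat.one_le_cast.mpr (Nat.one_le_iff_ne_zero.mpr hn))
  rw [← Real.natCeil_logb_natCast]
  exact_mod_cast (Nat.ceil_lt_add_one hlog).le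

lemma sizeBound_purification (huv : 1 ≤ u + v) : SizeBound (purification u v T hL) 26 2 := by
  have hlog : 0 ≤ Real.logb 2 L := Real.logb_nonneg one_lt_two (Nat.one_le_cast.mpr hL)
  have hN : Real.logb 2 (2 ^ (u + v) : ℕ) = (u + v : ℕ) := by simp [Real.logb_pow]
  have hK : Real.logb 2 (2 ^ T * L : ℕ) = T + Real.logb 2 L := by
    rw [Nat.cast_mul, Real.logb_mul (by positivity) (by positivity)]
    simp [Real.logb_pow]
  have huv' : (1 : ℝ) ≤ (u + v : ℕ) := Nat.one_le_cast.mpr huv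
  have hclog := clog_two_le_logb_add_one hL.ne'
  have hT : (0 : ℝ) ≤ T := T.cast_nonneg
  rw [SizeBound, size_purification, hN, hK]
  push_cast at huv' ⊢
  nlinarith [mul_nonneg hT (zero_le_one.trans huv'), mul_nonneg hlog hT,
    mul_nonneg hlog (zero_le_one.trans huv'), sq_nonneg (T : ℝ), sq_nonneg (Real.logb 2 L)]

end Size

theorem theorem3_general : ∃ C c : ℕ, ∀ m t L u : ℕ, 1 ≤ m → u ≤ m → 0 < L → ∀ ε : ℝ, ε ≤ 7 / 8 →
    ∃ P : Protocol (2 ^ m) (L * 2 ^ (2 * t)) (2 ^ u * L),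
      SizeBound P C c ∧ P.ProbSuccessful ε (ε / (2 : ℝ) ^ ((t : ℤ) - 3)) ε (1 / 2 ^ t) := by
  refine ⟨26, 2, fun m t L u hm hum hL ε hε => ?_⟩
  obtain ⟨v, rfl⟩ := Nat.exists_eq_add_of_le hum
  rw [mul_comm L]
  refine ⟨purification u v (2 * t) hL, sizeBound_purification hm, isGEPP_purification,
    fun ρ hρ hρε => ?_⟩
  have hε₀ : 0 ≤ ε := by linarith [fidelity_le_one hρ]
  refine prob_purification_le hρ hρε (by positivity) (by positivity) ?_
  calc ε / 2 ^ (2 * t) ≤ 8 * (1 - ε) * ε / 2 ^ (2 * t) := by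
        gcongr
        exact le_mul_of_one_le_left hε₀ (by linarith)
    _ = ε / (2 : ℝ) ^ ((t : ℤ) - 3) * (1 / 2 ^ t * (1 - ε)) := by
        rw [zpow_sub₀ two_ne_zero, zpow_natCast]
        norm_num
        field_simp
        ring

theorem theorem3 :
    (∃ C c : ℕ, ∀ n t : ℕ, t < n → ∀ ε : ℝ, ε < 1 / 2 →
      ∃ P : Protocol (2 ^ n) ((2 ^ n - 1) * 2 ^ (2 * t)) (2 ^ (n - t) * (2 ^ n - 1)),
        SizeBound P C c ∧
        P.ProbSuccessful ε (ε / (2 : ℝ) ^ ((t : ℤ) - 3))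
          (2 * ε + Real.sqrt (2 * ε / 2 ^ t)) (1 / 2 ^ t)) ∧
    (∃ C c : ℕ, ∀ n t : ℕ, t < n → ∀ ε : ℝ, ε < 1 / 2 →
      ∃ P : Protocol (2 ^ (2 * n)) ((2 ^ n + 1) * 2 ^ (2 * t)) (2 ^ n * (2 ^ n + 1)),
        SizeBound P C c ∧
        P.ProbSuccessful ε (ε / (2 : ℝ) ^ ((t : ℤ) - 3))
          (2 * ε + Real.sqrt (2 * ε / 2 ^ t)) (1 / 2 ^ t)) ∧
    (∃ C c : ℕ, ∀ n t d : ℕ, t < n → 1 ≤ d → ∀ ε : ℝ, ε < 1 / 2 →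
      ∃ P : Protocol (2 ^ (d * n)) ((2 ^ (d * n) - 1) / (2 ^ n - 1) * 2 ^ (2 * t))
          (2 ^ ((d - 1) * n) * ((2 ^ (d * n) - 1) / (2 ^ n - 1))),
        SizeBound P C c ∧
        P.ProbSuccessful ε (ε / (2 : ℝ) ^ ((t : ℤ) - 3))
          (2 * ε + Real.sqrt (2 * ε / 2 ^ t)) (1 / 2 ^ t)) := by
  obtain ⟨C, c, hgeneral⟩ := theorem3_general
  have hfamily (m t L u : ℕ) (hm : 1 ≤ m) (hu : u ≤ m) (hL : 0 < L) (ε : ℝ) (hε : ε < 1 / 2) :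
      ∃ P : Protocol (2 ^ m) (L * 2 ^ (2 * t)) (2 ^ u * L), SizeBound P C c ∧
        P.ProbSuccessful ε (ε / (2 : ℝ) ^ ((t : ℤ) - 3)) (2 * ε + √(2 * ε / 2 ^ t))
          (1 / 2 ^ t) := by
    obtain ⟨P, hsize, hP⟩ := hgeneral m t L u hm hu hL ε (by linarith)
    exact ⟨P, hsize, hP.mono_fail fun _ => by linarith [Real.sqrt_nonneg (2 * ε / 2 ^ t)]⟩
  have hpos {n t : ℕ} (ht : t < n) : 0 < 2 ^ n - 1 :=
    Nat.sub_pos_of_lt (Nat.one_lt_two_pow (by omega))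
  refine ⟨⟨C, c, fun n t ht => hfamily n t _ _ (by omega) (Nat.sub_le n t) (hpos ht)⟩,
    ⟨C, c, fun n t ht => hfamily (2 * n) t _ _ (by omega) (by omega) (Nat.succ_pos _)⟩,
    ⟨C, c, fun n t d ht hd => ?_⟩⟩
  have hn : n ≤ d * n := Nat.le_mul_of_pos_left n hd
  exact hfamily (d * n) t _ _ (by omega) (Nat.mul_le_mul_right n (Nat.sub_le d 1))
    (Nat.div_pos (Nat.sub_le_sub_right (Nat.pow_le_pow_right two_pos hn) 1) (hpos ht))
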